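/- **Setting (focusing case).** Let $m,\mathcal N\ge 0$ be integers, $k_0>0$, $(x,t)\in\mathbb R^2$, and let $Q_+$ be a complex $m\times m$ matrix. Put $$D^{\pm}=\{z\in\mathbb C:\ \pm(|z|^2-k_0^2)\,\mathrm{Im}\,z>0\},\qquad \Sigma=\mathbb R\cup\{|z|=k_0\},$$ where $\Sigma$ is oriented so that $D^+$ lies to its left, that is: $(-\infty,-k_0]$ and $[k_0,\infty)$ are run through from left to right, $[-k_0,k_0]$ from right to left, and both half circles of $|z|=k_0$ from $-k_0$ to $k_0$. Put $k(z)=\frac12(z-k_0^2/z)$, $\lambda(z)=\frac12(z+k_0^2/z)$, $\theta(x,t;z)=\lambda(z)\bigl(x+(4k(z)^2+2k_0^2)t\bigr)$, $$\underline\sigma_3=\begin{pmatrix}I_m&0\\0&-I_m\end{pmatrix},\qquad \underline Q_+=\begin{pmatrix}0&Q_+\\-Q_+^\dagger&0\end{pmatrix},\qquad G(x,t;z)=\begin{pmatrix}0&-e^{-2i\theta(x,t;z)}\bar\rho(z)\\ e^{2i\theta(x,t;z)}\rho(z)&\rho(z)\bar\rho(z)\end{pmatrix},$$ with arbitrary $m\times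 m$ matrix functions $\rho,\bar\rho$ on $\Sigma$ (the reflection coefficients). *Simple zeros.* Let $z_1,\dots,z_{\mathcal N}$ be distinct points of $D^+\cap\{\mathrm{Im}\,z>0\}$, and put $\zeta_n=z_n$, $\zeta_{n+\mathcal N}=-k_0^2/z_n^*$ for $n=1,\dots,\mathcal N$. Let $a$ be an $m\times m$ matrix function holomorphic in $D^+$ such that the zeros of $\det a$ in $D^+$ are exactly $\zeta_1,\dots,\zeta_{2\mathcal N}$, all simple, and $\bar a$ an $m\times m$ matrix function holomorphic in $D^-$ such that the zeros of $\det\bar a$ in $D^-$ are exactly $\zeta_1^*,\dots,\zeta_{2\mathcal N}^*$, all simple. *Riemann–Hilbert problem.* A solution is a sectionally meromorphic $2m\times2m$ matrix function $\mathcal Q(x,t;z)$, equal to $\mathcal Q^{\pm}(x,t;z)$ in $D^{\pm}$, such that * $\mathcal Q^+=(\hat{\mathcal W}a^{-1},\hat{\mathcal V})$ in $D^+\setminus\{\zeta_n\}$ and $\mathcal Q^-=(\bar{\mathcal V},\bar{\mathcal W}\bar a^{-1})$ in $D^-\setminus\{\zeta_n^*\}$, where $\hat{\mathcal W},\hat{\mathcal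 V}$ are $2m\times m$ matrix functions holomorphic in $D^+$ and $\bar{\mathcal V},\bar{\mathcal W}$ are $2m\times m$ matrix functions holomorphic in $D^-$; away from these poles, $\mathcal Q^{\pm}$ are continuous up to $\Sigma\setminus\{0\}$; * $\mathcal Q^-(x,t;z)=\mathcal Q^+(x,t;z)\,(I_{2m}-G(x,t;z))$ for $z\in\Sigma\setminus\{0\}$; * $\mathcal Q^{\pm}=I_{2m}+O(1/z)$ as $z\to\infty$ in $D^\pm$, and $\mathcal Q^{\pm}=-\frac iz\underline\sigma_3\underline Q_++O(1)$ as $z\to0$ in $D^\pm$. **Proposition.** Every solution $\mathcal Q$ of this Riemann–Hilbert problem satisfies, for all $z\in\mathbb C\setminus\Sigma$ with $z\ne\zeta_n,\zeta_n^*$ $(n=1,\dots,2\mathcal N)$, $$\mathcal Q(x,t;z)=I_{2m}-\frac iz\,\underline\sigma_3\underline Q_++\sum_{n=1}^{2\mathcal N}\frac{\operatorname{Res}_{z=\zeta_n}\mathcal Q^+}{z-\zeta_n}+\sum_{n=1}^{2\mathcal N}\frac{\operatorname{Res}_{z=\zeta_n^*}\mathcal Q^-}{z-\zeta_n^*}+\frac1{2\pi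 i}\int_\Sigma\frac{(\mathcal Q^+G)(x,t;\xi)}{\xi-z}\,d\xi,$$ and the integral over $\Sigma$ converges absolutely. -/

import Mathlib

open Complex Filter Topology MeasureTheory

noncomputable section

namespace MmKdV

/-- Complex `m × m` matrices. -/
abbrev Mat (m : ℕ) : Type := Matrix (Fin m) (Fin m) ℂ

/-- Complex `2m × 2m` matrices, written in `m × m` blocks. -/
abbrev BlockMat (m : ℕ) : Type := Matrix (Fin m ⊕ Fin m) (Fin m ⊕ Fin m) ℂ

/-- Complex `2m × m` matrices (block columns). -/
abbrev BlockCol (m : ℕ) : Type := Matrix (Fin m ⊕ Fin m) (Fin m) ℂ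

/-! ### The spectral plane in the focusing case -/

/-- `D⁺ = {z : (|z|² - k₀²) Im z > 0}`. -/
def Dplus (k₀ : ℝ) : Set ℂ := {z | 0 < (‖z‖ ^ 2 - k₀ ^ 2) * z.im}

/-- `D⁻ = {z : (|z|² - k₀²) Im z < 0}`. -/
def Dminus (k₀ : ℝ) : Set ℂ := {z | (‖z‖ ^ 2 - k₀ ^ 2) * z.im < 0}

/-- The continuous spectrum `Σ`: the real line together with the circle `|z| = k₀`. -/
def Spec (k₀ : ℝ) : Set ℂ := {z | z.im = 0 ∨ ‖z‖ = k₀}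

/-- `k(z) = (z - k₀² / z) / 2`. -/
def kFun (k₀ : ℝ) (z : ℂ) : ℂ := (z - (k₀ : ℂ) ^ 2 / z) / 2

/-- `λ(z) = (z + k₀² / z) / 2`. -/
def lambdaFun (k₀ : ℝ) (z : ℂ) : ℂ := (z + (k₀ : ℂ) ^ 2 / z) / 2

/-- `θ(x,t;z) = λ(z) (x + (4 k(z)² + 2 k₀²) t)`. -/
def theta (k₀ x t : ℝ) (z : ℂ) : ℂ :=
  lambdaFun k₀ z * ((x : ℂ) + (4 * kFun k₀ z ^ 2 + 2 * (k₀ : ℂ) ^ 2) * (t : ℂ))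

/-- The points `ζₙ = zₙ` and `ζ_{n+N} = -k₀² / zₙ*`; the first summand of the index type
stands for `1, …, N`, the second for `N+1, …, 2N`. -/
def zeta (k₀ : ℝ) {N : ℕ} (z : Fin N → ℂ) : Fin N ⊕ Fin N → ℂ :=
  Sum.elim z (fun n => -(k₀ : ℂ) ^ 2 / (starRingEnd ℂ) (z n))

/-- The points `ζₙ*`. -/
def zetaConj (k₀ : ℝ) {N : ℕ} (z : Fin N → ℂ) (n : Fin N ⊕ Fin N) : ℂ :=
  (starRingEnd ℂ) (zeta k₀ z n)

/-! ### Block matrices -/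

/-- `σ₃ = diag(I_m, -I_m)`. -/
def sigma3 (m : ℕ) : BlockMat m := Matrix.fromBlocks 1 0 0 (-1)

/-- The `2m × 2m` matrix with off-diagonal blocks `Q` and `ε Q†`, where `ε = -1`. -/
def underline {m : ℕ} (Q : Mat m) : BlockMat m :=
  Matrix.fromBlocks 0 Q (-Q.conjTranspose) 0

/-- The matrix `G(x,t;z)` with blocks `0`, `-e^{-2iθ} ρ̄`, `e^{2iθ} ρ`, `ρ ρ̄`, so that the jump
matrix of the Riemann-Hilbert problem is `I - G`. -/
def jumpG {m : ℕ} (k₀ x t : ℝ) (ρ ρbar : ℂ → Mat m) (z : ℂ) : BlockMat m :=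
  Matrix.fromBlocks 0 (-(exp (-2 * I * theta k₀ x t z) • ρbar z))
    (exp (2 * I * theta k₀ x t z) • ρ z) (ρ z * ρbar z)

/-! ### Holomorphy, simple zeros, residues -/

/-- Entrywise holomorphy of a matrix-valued function on a set (used on open sets). -/
def Holo {α β : Type} (A : ℂ → Matrix α β ℂ) (U : Set ℂ) : Prop :=
  ∀ i j, DifferentiableOn ℂ (fun z => A z i j) U

/-- `a` is holomorphic on `U`, and the zeros of `det a` in `U` are exactly the points `p n`,
all of them simple. -/
structure HasSimpleZeros {m : ℕ} {ι : Type} (a : ℂ → Mat m) (U : Set ℂ) (p : ι → ℂ) :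
    Prop where
  holo : Holo a U
  mem : ∀ n, p n ∈ U
  zero_iff : ∀ z ∈ U, (a z).det = 0 ↔ ∃ n, z = p n
  simple : ∀ n, deriv (fun z => (a z).det) (p n) ≠ 0

/-- The residue of `f` at (an isolated singularity) `c`: the value of `(2πi)⁻¹ ∮ f` over all
sufficiently small circles about `c`. -/
def residue (f : ℂ → ℂ) (c : ℂ) : ℂ :=
  limUnder (𝓝[>] (0 : ℝ)) (fun r => (2 * (Real.pi : ℂ) * I)⁻¹ * ∮ w in C(c, r), f w)

/-- The entrywise residue of a matrix-valued function. -/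
def matResidue {α β : Type} (A : ℂ → Matrix α β ℂ) (c : ℂ) : Matrix α β ℂ :=
  Matrix.of fun i j => residue (fun w => A w i j) c

/-! ### Integration along the contour

`Σ` is oriented so that `D⁺` lies to its left: the rays `(-∞, -k₀]` and `[k₀, ∞)` are run
through from left to right, the segment `[-k₀, k₀]` from right to left, and both half circles
from `-k₀` to `k₀`. -/

/-- The pull-back of `f dξ` to the circle `ξ = k₀ e^{iφ}`. -/
def arcPullback (k₀ : ℝ) (f : ℂ → ℂ) (φ : ℝ) : ℂ :=
  f ((k₀ : ℂ) * exp (φ * I)) * ((k₀ : ℂ) * I * exp (φ * I))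

/-- Absolute integrability of `f` along `Σ`. -/
structure IntegrableOnSpec (k₀ : ℝ) (f : ℂ → ℂ) : Prop where
  real_line : Integrable (fun s : ℝ => f (s : ℂ))
  circle : IntegrableOn (arcPullback k₀ f) (Set.Ioc (-Real.pi) Real.pi)

/-- `∫_Σ f(ξ) dξ`. -/
def specIntegral (k₀ : ℝ) (f : ℂ → ℂ) : ℂ :=
  (∫ s in Set.Iic (-k₀), f (s : ℂ)) + (∫ s in Set.Ici k₀, f (s : ℂ))
    + (∫ s in k₀..(-k₀), f (s : ℂ))
    + (∫ φ in Real.pi..0, arcPullback k₀ f φ)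
    + (∫ φ in (-Real.pi)..0, arcPullback k₀ f φ)

/-- The entrywise integral along `Σ` of a matrix-valued function. -/
def matSpecIntegral {α β : Type} (k₀ : ℝ) (A : ℂ → Matrix α β ℂ) : Matrix α β ℂ :=
  Matrix.of fun i j => specIntegral k₀ (fun ξ => A ξ i j)

/-! ### The Riemann-Hilbert problem -/

/-- The pair `(Qp, Qm)` solves the generalized Riemann-Hilbert problem at `(x,t)` with boundary
matrix `Qbdry = Q₊`, diagonal scattering coefficients `a`, `abar`, reflection coefficients
`ρ`, `ρbar`. Here `Qp` and `Qm` stand for the two branches `𝒬⁺` and `𝒬⁻` of the sectionally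
meromorphic matrix `𝒬`, together with their boundary values on `Σ`. -/
structure IsRHSolution {m : ℕ} (k₀ x t : ℝ) (Qbdry : Mat m) (a abar ρ ρbar : ℂ → Mat m)
    (Qp Qm : ℂ → BlockMat m) : Prop where
  /-- In `D⁺`, `𝒬⁺ = (Ŵ a⁻¹, V̂)` with `Ŵ`, `V̂` holomorphic. -/
  form_plus : ∃ W V : ℂ → BlockCol m, Holo W (Dplus k₀) ∧ Holo V (Dplus k₀) ∧
    ∀ z ∈ Dplus k₀, (a z).det ≠ 0 → Qp z = Matrix.fromCols (W z * (a z)⁻¹) (V z)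
  /-- In `D⁻`, `𝒬⁻ = (V̄, W̄ ā⁻¹)` with `V̄`, `W̄` holomorphic. -/
  form_minus : ∃ V W : ℂ → BlockCol m, Holo V (Dminus k₀) ∧ Holo W (Dminus k₀) ∧
    ∀ z ∈ Dminus k₀, (abar z).det ≠ 0 → Qm z = Matrix.fromCols (V z) (W z * (abar z)⁻¹)
  /-- Away from its poles, `𝒬⁺` is continuous up to `Σ ∖ {0}`. -/
  cont_plus : ContinuousOn Qp
    ({z ∈ Dplus k₀ | (a z).det ≠ 0} ∪ (Spec k₀ \ {0}))
  /-- Away from its poles, `𝒬⁻` is continuous up to `Σ ∖ {0}`. -/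
  cont_minus : ContinuousOn Qm
    ({z ∈ Dminus k₀ | (abar z).det ≠ 0} ∪ (Spec k₀ \ {0}))
  /-- The jump condition. -/
  jump : ∀ z ∈ Spec k₀ \ {0}, Qm z = Qp z * (1 - jumpG k₀ x t ρ ρbar z)
  /-- `𝒬± = I + O(1/z)` as `z → ∞`. -/
  infty_plus : ∀ i j, (fun z => (Qp z - 1) i j)
    =O[Bornology.cobounded ℂ ⊓ 𝓟 (Dplus k₀)] (fun z => z⁻¹)
  infty_minus : ∀ i j, (fun z => (Qm z - 1) i j)
    =O[Bornology.cobounded ℂ ⊓ 𝓟 (Dminus k₀)] (fun z => z⁻¹)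
  /-- `𝒬± = -(i/z) σ₃ Q₊ + O(1)` as `z → 0`. -/
  zero_plus : ∀ i j, (fun z => (Qp z + (I / z) • (sigma3 m * underline Qbdry)) i j)
    =O[𝓝[Dplus k₀] 0] (fun _ => (1 : ℂ))
  zero_minus : ∀ i j, (fun z => (Qm z + (I / z) • (sigma3 m * underline Qbdry)) i j)
    =O[𝓝[Dminus k₀] 0] (fun _ => (1 : ℂ))

open Classical in
/-- The sectionally meromorphic matrix `𝒬` on `ℂ ∖ Σ`: `𝒬⁺` in `D⁺` and `𝒬⁻` in `D⁻`. -/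
def sectional {m : ℕ} (k₀ : ℝ) (Qp Qm : ℂ → BlockMat m) (z : ℂ) : BlockMat m :=
  if z ∈ Dplus k₀ then Qp z else Qm z

end MmKdV

end

open MmKdV

open MmKdV

namespace MmKdV

/-! ### Cauchy's theorem on half annuli -/

/-! The formula is Cauchy's theorem applied to one auxiliary function, entry by entry. Let `q` be an
entry of the sectional matrix, `P` the rational function collecting its value `e` at infinity, its
pole at `0` and its simple poles in both `D⁺` and `D⁻`. Fix `w` off the contour and put `c = q(w) -
P(w)`. The quotients `F± = (q± - P - c) / (z - w)` are holomorphic in `D±`: subtracting `P` removes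
the poles, subtracting `c` removes the one at `w`. They are bounded at `0` and equal `-c/z +
O(1/z²)` at infinity. Since `P` and `c` are the same on both sides, the jump of `F` on `Σ` is `(q⁺ -
q⁻) / (z - w)`, an entry of `Q⁺G / (ξ - w)`.

The circle `|z| = k₀` and the real line cut the plane into four half annuli (radii in `(0, k₀)` and
`(k₀, ∞)`). Adding Cauchy's theorem over them leaves the integral of the jump along `Σ`, the small
arcs, which vanish, and the large arcs, which contribute `-2πi c`. Hence the jump integrates to `2πi
c` (`specIntegral_jump`), and solving `c = q(w) - P(w)` for `q(w)` gives the claim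
(`sectional_representation`). The quotient is built in `exists_cauchy_quotient`; the simple poles
come from `a⁻¹ = adj a / det a`. -/

lemma arcPullback_neg (r : ℝ) (F : ℂ → ℂ) (φ : ℝ) :
    arcPullback r (fun z => F (-z)) (φ + Real.pi) = -arcPullback r F φ := by
  have h : exp (((φ + Real.pi : ℝ) : ℂ) * I) = -exp (φ * I) := by
    push_cast
    rw [add_mul, exp_add, exp_pi_mul_I]; ring
  unfold arcPullback
  rw [h]
  simp

/-- Cauchy's theorem on the upper half annulus `r < |z| < R`, `Im z > 0`. -/
lemma integral_upper_half_annulus {r R : ℝ} (hr : 0 < r) (hrR : r ≤ R) {F : ℂ → ℂ}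
    (hc : ContinuousOn F {z | r ≤ ‖z‖ ∧ ‖z‖ ≤ R ∧ 0 ≤ z.im})
    (hd : DifferentiableOn ℂ F {z | r < ‖z‖ ∧ ‖z‖ < R ∧ 0 < z.im}) :
    (∫ s in r..R, F (s : ℂ)) + (∫ s in (-R)..(-r), F (s : ℂ))
      + (∫ φ in (0 : ℝ)..Real.pi, arcPullback R F φ)
      - (∫ φ in (0 : ℝ)..Real.pi, arcPullback r F φ) = 0 := by
  have hR : 0 < R := hr.trans_le hrR
  have hlog : Real.log r ≤ Real.log R := Real.log_le_log hr hrR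
  have hnorm : ∀ u : ℂ, ‖exp u‖ = Real.exp u.re := fun u => norm_exp u
  have him : ∀ u : ℂ, (exp u).im = Real.exp u.re * Real.sin u.im := fun u => exp_im u
  -- The exponential carries the rectangle `[log r, log R] × [0, π]` onto the closed half annulus,
  -- and `F(z) dz` pulls back to `F(exp u) exp u du`. The four sides become the two real segments
  -- and the two arcs.
  have key := integral_boundary_rect_eq_zero_of_continuousOn_of_differentiableOn
    (fun u => F (exp u) * exp u) (⟨Real.log r, 0⟩ : ℂ) (⟨Real.log R, Real.pi⟩ : ℂ) ?_ ?_
  · simp only at key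
    have e1 : (∫ x in Real.log r..Real.log R, F (exp ((x : ℂ) + ((0 : ℝ) : ℂ) * I))
        * exp ((x : ℂ) + ((0 : ℝ) : ℂ) * I)) = ∫ s in r..R, F (s : ℂ) := by
      have := intervalIntegral.integral_deriv_smul_comp'' (a := Real.log r) (b := Real.log R)
        (f := Real.exp) (f' := Real.exp) (g := fun s : ℝ => F (s : ℂ))
        Real.continuous_exp.continuousOn
        (fun x _ => (Real.hasDerivAt_exp x).hasDerivWithinAt) Real.continuous_exp.continuousOn ?_
      · rw [Real.exp_log hr, Real.exp_log hR] at this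
        rw [← this]
        refine intervalIntegral.integral_congr fun x _ => ?_
        simp [mul_comm]
      · refine hc.comp continuous_ofReal.continuousOn ?_
        rintro _ ⟨x, hx, rfl⟩
        rw [Set.uIcc_of_le hlog] at hx
        have h1 := (Real.log_le_iff_le_exp hr).1 hx.1
        have h2 := (Real.le_log_iff_exp_le hR).1 hx.2
        simp only [Set.mem_ofPred_eq, norm_real, Real.norm_eq_abs, Real.abs_exp, ofReal_im, le_refl,
          and_true]
        exact ⟨h1, h2⟩
    have e2 : (∫ x in Real.log r..Real.log R, F (exp ((x : ℂ) + ((Real.pi : ℝ) : ℂ) * I))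
        * exp ((x : ℂ) + ((Real.pi : ℝ) : ℂ) * I)) = -∫ s in (-R)..(-r), F (s : ℂ) := by
      have := intervalIntegral.integral_deriv_smul_comp'' (a := Real.log r) (b := Real.log R)
        (f := fun x => -Real.exp x) (f' := fun x => -Real.exp x) (g := fun s : ℝ => F (s : ℂ))
        Real.continuous_exp.neg.continuousOn
        (fun x _ => (Real.hasDerivAt_exp x).neg.hasDerivWithinAt)
        Real.continuous_exp.neg.continuousOn ?_
      · rw [Real.exp_log hr, Real.exp_log hR, intervalIntegral.integral_symm (-R) (-r)] at this
        rw [← this]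
        refine intervalIntegral.integral_congr fun x _ => ?_
        simp [exp_add, exp_pi_mul_I, mul_comm (exp (x : ℂ))]
      · refine hc.comp continuous_ofReal.continuousOn ?_
        rintro _ ⟨x, hx, rfl⟩
        rw [Set.uIcc_of_le hlog] at hx
        have h1 := (Real.log_le_iff_le_exp hr).1 hx.1
        have h2 := (Real.le_log_iff_exp_le hR).1 hx.2
        simp only [Set.mem_ofPred_eq, norm_real, Real.norm_eq_abs, abs_neg, Real.abs_exp, ofReal_im,
          le_refl, and_true]
        exact ⟨h1, h2⟩
    have e3 : ∀ ρ : ℝ, 0 < ρ → I • (∫ y in (0 : ℝ)..Real.pi,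
        F (exp (((Real.log ρ : ℝ) : ℂ) + (y : ℂ) * I)) * exp (((Real.log ρ : ℝ) : ℂ) + (y : ℂ) * I))
        = ∫ φ in (0 : ℝ)..Real.pi, arcPullback ρ F φ := by
      intro ρ hρ
      rw [smul_eq_mul, ← intervalIntegral.integral_const_mul]
      refine intervalIntegral.integral_congr fun x _ => ?_
      simp only [arcPullback, exp_add, ← ofReal_exp, Real.exp_log hρ]
      ring
    rw [e1, e2, e3 r hr, e3 R hR] at key
    linear_combination key
  · refine ContinuousOn.mul (hc.comp continuous_exp.continuousOn ?_) continuous_exp.continuousOn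
    intro u hu
    simp only [mem_reProdIm, Set.uIcc_of_le hlog, Set.uIcc_of_le Real.pi_pos.le] at hu
    obtain ⟨⟨h1, h2⟩, h3, h4⟩ := hu
    refine ⟨?_, ?_, ?_⟩
    · rw [hnorm]; exact (Real.log_le_iff_le_exp hr).1 h1
    · rw [hnorm]; exact (Real.le_log_iff_exp_le hR).1 h2
    · rw [him]; exact mul_nonneg (Real.exp_pos _).le (Real.sin_nonneg_of_nonneg_of_le_pi h3 h4)
  · refine DifferentiableOn.mul (hd.comp differentiable_exp.differentiableOn ?_)
      differentiable_exp.differentiableOn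
    intro u hu
    simp only [mem_reProdIm, min_eq_left hlog, max_eq_right hlog, min_eq_left Real.pi_pos.le,
      max_eq_right Real.pi_pos.le] at hu
    obtain ⟨⟨h1, h2⟩, h3, h4⟩ := hu
    refine ⟨?_, ?_, ?_⟩
    · rw [hnorm]; exact (Real.log_lt_iff_lt_exp hr).1 h1
    · rw [hnorm]; exact (Real.lt_log_iff_exp_lt hR).1 h2
    · rw [him]; exact mul_pos (Real.exp_pos _) (Real.sin_pos_of_pos_of_lt_pi h3 h4)

/-- Cauchy's theorem on the lower half annulus `r < |z| < R`, `Im z < 0`. -/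
lemma integral_lower_half_annulus {r R : ℝ} (hr : 0 < r) (hrR : r ≤ R) {F : ℂ → ℂ}
    (hc : ContinuousOn F {z | r ≤ ‖z‖ ∧ ‖z‖ ≤ R ∧ z.im ≤ 0})
    (hd : DifferentiableOn ℂ F {z | r < ‖z‖ ∧ ‖z‖ < R ∧ z.im < 0}) :
    -(∫ s in r..R, F (s : ℂ)) - (∫ s in (-R)..(-r), F (s : ℂ))
      + (∫ φ in (-Real.pi)..0, arcPullback R F φ)
      - (∫ φ in (-Real.pi)..0, arcPullback r F φ) = 0 := by
  -- The rotation `z ↦ -z` exchanges the half annuli; it swaps the two real segments and shifts the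
  -- arcs by `π`.
  have key := integral_upper_half_annulus (F := fun z => F (-z)) hr hrR
    (hc.comp continuous_neg.continuousOn fun z hz => by simpa using hz)
    (hd.comp differentiable_neg.differentiableOn fun z hz => by simpa using hz)
  have e1 : (∫ s in r..R, F (-(s : ℂ))) = ∫ s in (-R)..(-r), F (s : ℂ) := by
    rw [← intervalIntegral.integral_comp_neg (fun s : ℝ => F (s : ℂ))]
    simp
  have e2 : (∫ s in (-R)..(-r), F (-(s : ℂ))) = ∫ s in r..R, F (s : ℂ) := by
    have := intervalIntegral.integral_comp_neg (a := -R) (b := -r) (fun s : ℝ => F (s : ℂ))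
    simpa using this
  have e3 : ∀ ρ : ℝ, (∫ φ in (0 : ℝ)..Real.pi, arcPullback ρ (fun z => F (-z)) φ)
      = -∫ φ in (-Real.pi)..0, arcPullback ρ F φ := by
    intro ρ
    have := intervalIntegral.integral_comp_add_right (a := -Real.pi) (b := 0)
      (arcPullback ρ (fun z => F (-z))) Real.pi
    simp only [arcPullback_neg, neg_add_cancel, zero_add] at this
    rw [← this, intervalIntegral.integral_neg]
  rw [e1, e2, e3, e3] at key
  linear_combination -key

/-! ### Geometry of the regions `D±` -/

lemma mem_Dplus_iff {k₀ : ℝ} {z : ℂ} : z ∈ Dplus k₀ ↔ 0 < (‖z‖ ^ 2 - k₀ ^ 2) * z.im := Iff.rfl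

lemma mem_Dminus_iff {k₀ : ℝ} {z : ℂ} : z ∈ Dminus k₀ ↔ (‖z‖ ^ 2 - k₀ ^ 2) * z.im < 0 := Iff.rfl

lemma isOpen_Dplus (k₀ : ℝ) : IsOpen (Dplus k₀) :=
  isOpen_lt continuous_const (by fun_prop)

lemma isOpen_Dminus (k₀ : ℝ) : IsOpen (Dminus k₀) :=
  isOpen_lt (by fun_prop) continuous_const

lemma mem_Spec_iff {k₀ : ℝ} (hk₀ : 0 < k₀) {z : ℂ} :
    z ∈ Spec k₀ ↔ (‖z‖ ^ 2 - k₀ ^ 2) * z.im = 0 := by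
  rw [mul_eq_zero, sub_eq_zero, sq_eq_sq₀ (norm_nonneg z) hk₀.le]
  exact or_comm

lemma disjoint_Dplus_Spec {k₀ : ℝ} (hk₀ : 0 < k₀) : Disjoint (Dplus k₀) (Spec k₀) :=
  Set.disjoint_left.2 fun _ hz hz' => hz.ne' ((mem_Spec_iff hk₀).1 hz')

lemma disjoint_Dminus_Spec {k₀ : ℝ} (hk₀ : 0 < k₀) : Disjoint (Dminus k₀) (Spec k₀) :=
  Set.disjoint_left.2 fun _ hz hz' => hz.ne ((mem_Spec_iff hk₀).1 hz')

lemma disjoint_Dplus_Dminus {k₀ : ℝ} : Disjoint (Dplus k₀) (Dminus k₀) :=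
  Set.disjoint_left.2 fun _ hz hz' => lt_asymm (mem_Dplus_iff.1 hz) (mem_Dminus_iff.1 hz')

lemma mem_Dplus_union {k₀ : ℝ} (hk₀ : 0 < k₀) {z : ℂ} (h0 : z ≠ 0)
    (h : 0 ≤ (‖z‖ ^ 2 - k₀ ^ 2) * z.im) : z ∈ Dplus k₀ ∪ (Spec k₀ \ {0}) := by
  rcases h.lt_or_eq with h | h
  · exact Or.inl h
  · exact Or.inr ⟨(mem_Spec_iff hk₀).2 h.symm, h0⟩

lemma mem_Dminus_union {k₀ : ℝ} (hk₀ : 0 < k₀) {z : ℂ} (h0 : z ≠ 0)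
    (h : (‖z‖ ^ 2 - k₀ ^ 2) * z.im ≤ 0) : z ∈ Dminus k₀ ∪ (Spec k₀ \ {0}) := by
  rcases h.lt_or_eq with h | h
  · exact Or.inl h
  · exact Or.inr ⟨(mem_Spec_iff hk₀).2 h, h0⟩

lemma ofReal_mem_Spec (k₀ s : ℝ) : (s : ℂ) ∈ Spec k₀ := Or.inl (ofReal_im s)

/-- Growth is assumed only inside `D±`, but the bounds are needed on the real line too. Moving a
real point vertically by `ε d`, with `d = |z|² - k₀²`, gives `Im z` the sign of `d`, so the point
enters `D⁺` for small `ε > 0`; `|z| ≠ k₀` ensures `d ≠ 0`. -/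
lemma mem_closure_Dplus {k₀ : ℝ} {z : ℂ} (hk₀ : 0 < k₀) (hz : z.im = 0) (hn : ‖z‖ ≠ k₀) :
    z ∈ closure (Dplus k₀) := by
  set d : ℝ := ‖z‖ ^ 2 - k₀ ^ 2 with hd
  have hd0 : d ≠ 0 := by
    rw [hd, sub_ne_zero]
    exact fun h => hn ((sq_eq_sq₀ (norm_nonneg z) hk₀.le).1 h)
  have ht : Tendsto (fun ε : ℝ => z + ((ε * d : ℝ) : ℂ) * I) (𝓝[>] 0) (𝓝 z) := by
    have : Continuous (fun ε : ℝ => z + ((ε * d : ℝ) : ℂ) * I) := by fun_prop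
    have h := this.tendsto 0
    simp only [zero_mul, ofReal_zero, add_zero] at h
    exact h.mono_left nhdsWithin_le_nhds
  refine mem_closure_of_tendsto ht ?_
  have hpos : ∀ᶠ ε : ℝ in 𝓝[>] 0, 0 < 1 + ε ^ 2 * d := by
    have : Continuous (fun ε : ℝ => 1 + ε ^ 2 * d) := by fun_prop
    exact nhdsWithin_le_nhds ((this.tendsto 0).eventually (lt_mem_nhds (by simp)))
  filter_upwards [hpos, self_mem_nhdsWithin] with ε h1 h2
  have h2 : 0 < ε := h2
  have hnz : ‖z + ((ε * d : ℝ) : ℂ) * I‖ ^ 2 = ‖z‖ ^ 2 + (ε * d) ^ 2 := by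
    rw [← normSq_eq_norm_sq, ← normSq_eq_norm_sq, normSq_apply, normSq_apply]
    simp [hz]; ring
  have him : (z + ((ε * d : ℝ) : ℂ) * I).im = ε * d := by simp [hz]
  rw [mem_Dplus_iff, hnz, him]
  have : (‖z‖ ^ 2 + (ε * d) ^ 2 - k₀ ^ 2) * (ε * d) = (1 + ε ^ 2 * d) * (ε * d ^ 2) := by
    rw [show ‖z‖ ^ 2 = d + k₀ ^ 2 by rw [hd]; ring]; ring
  rw [this]
  positivity

lemma neg_mem_Dminus {k₀ : ℝ} {z : ℂ} (hz : z ∈ Dplus k₀) : -z ∈ Dminus k₀ := by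
  have : 0 < (‖z‖ ^ 2 - k₀ ^ 2) * z.im := hz
  rw [mem_Dminus_iff, norm_neg, neg_im]; linarith

lemma mem_closure_Dminus {k₀ : ℝ} {z : ℂ} (hk₀ : 0 < k₀) (hz : z.im = 0) (hn : ‖z‖ ≠ k₀) :
    z ∈ closure (Dminus k₀) := by
  have h := mem_closure_Dplus (z := -z) hk₀ (by simpa using hz) (by simpa using hn)
  have h' := closure_mono (s := Neg.neg '' Dplus k₀) (t := Dminus k₀)
    (by rintro _ ⟨u, hu, rfl⟩; exact neg_mem_Dminus hu)
  refine h' (image_closure_subset_closure_image continuous_neg ⟨-z, h, neg_neg z⟩)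

/-! ### Passing bounds to the boundary -/

/-- A bound valid on `U ∩ V`, `V` open, persists at the boundary points of `U` in `V` up to which
the function is continuous. -/
lemma norm_le_of_mem_closure {U E V : Set ℂ} {F : ℂ → ℂ} {b : ℂ → ℝ} (hUE : U ⊆ E)
    (hF : ContinuousOn F E) (hV : IsOpen V) (hb : ContinuousOn b V)
    (h : ∀ z ∈ U ∩ V, ‖F z‖ ≤ b z) {z : ℂ} (hzE : z ∈ E) (hzV : z ∈ V) (hzU : z ∈ closure U) :
    ‖F z‖ ≤ b z := by
  have hne : (𝓝[U ∩ V] z).NeBot := by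
    rw [← mem_closure_iff_nhdsWithin_neBot]
    exact hV.closure_inter ⟨hzU, hzV⟩
  refine le_of_tendsto_of_tendsto
    ((hF z hzE).mono (Set.inter_subset_left.trans hUE)).norm
    ((hb z hzV).mono Set.inter_subset_right) ?_
  filter_upwards [self_mem_nhdsWithin] with u hu using h u hu

lemma exists_bound_cobounded {U E : Set ℂ} {F : ℂ → ℂ} {c : ℂ} {k₀ : ℝ} (hk₀ : 0 < k₀)
    (hUE : U ⊆ E) (hcl : ∀ z ∈ E, ‖z‖ ≠ k₀ → z ∈ closure U) (h0 : (0 : ℂ) ∉ E)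
    (hF : ContinuousOn F E)
    (h : (fun z => F z + c / z) =O[Bornology.cobounded ℂ ⊓ 𝓟 U] (fun z => (z ^ 2)⁻¹)) :
    ∃ C R : ℝ, k₀ < R ∧ ∀ z ∈ E, R ≤ ‖z‖ → ‖F z + c / z‖ ≤ C / ‖z‖ ^ 2 := by
  obtain ⟨C, hC⟩ := h.bound
  rw [eventually_inf_principal, ← comap_norm_atTop, eventually_comap] at hC
  obtain ⟨R, hR⟩ := eventually_atTop.1 hC
  -- The radius is pushed beyond `k₀` because points of the circle are not covered by `hcl`.
  refine ⟨C, max R k₀ + 1, by linarith [le_max_right R k₀], fun z hz hzR => ?_⟩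
  have hlt : max R k₀ < ‖z‖ := by linarith
  have hb : ContinuousOn (fun z : ℂ => C / ‖z‖ ^ 2) {z | max R k₀ < ‖z‖} := by
    refine continuousOn_const.div (by fun_prop) fun u hu => ?_
    have : max R k₀ < ‖u‖ := hu
    have : 0 < ‖u‖ := hk₀.trans ((le_max_right R k₀).trans_lt this)
    positivity
  refine norm_le_of_mem_closure (V := {z | max R k₀ < ‖z‖}) (F := fun z => F z + c / z)
    (b := fun z => C / ‖z‖ ^ 2) hUE
    (hF.add (continuousOn_const.div continuousOn_id fun u hu hu0 => h0 (by simpa [← hu0] using hu)))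
    (isOpen_lt continuous_const continuous_norm) hb ?_ hz hlt
    (hcl z hz ((le_max_right R k₀).trans_lt hlt).ne')
  intro u hu
  have := hR ‖u‖ ((le_max_left R k₀).trans hu.2.le) u rfl hu.1
  simpa [div_eq_mul_inv] using this

lemma exists_bound_zero {U E : Set ℂ} {F : ℂ → ℂ} {k₀ : ℝ} (hk₀ : 0 < k₀)
    (hUE : U ⊆ E) (hcl : ∀ z ∈ E, ‖z‖ ≠ k₀ → z ∈ closure U)
    (hF : ContinuousOn F E) (h : F =O[𝓝[U] 0] (fun _ => (1 : ℂ))) :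
    ∃ C δ : ℝ, 0 < δ ∧ δ < k₀ ∧ ∀ z ∈ E, ‖z‖ ≤ δ → ‖F z‖ ≤ C := by
  obtain ⟨C, hC⟩ := h.bound
  obtain ⟨δ, hδ, hδC⟩ := Metric.eventually_nhds_iff.1 (eventually_nhdsWithin_iff.1 hC)
  simp only [dist_zero_right, norm_one, mul_one] at hδC
  refine ⟨C, min δ k₀ / 2, by positivity, ?_, fun z hz hzδ => ?_⟩
  · have := min_le_right δ k₀; linarith
  have hpos : 0 < min δ k₀ := by positivity
  have hlt : ‖z‖ < min δ k₀ := by linarith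
  exact norm_le_of_mem_closure (V := {z | ‖z‖ < min δ k₀}) (b := fun _ => C) hUE hF
    (isOpen_lt continuous_norm continuous_const) continuousOn_const
    (fun u hu => hδC (hu.2.trans_le (min_le_left _ _)) hu.1) hz hlt
    (hcl z hz (hlt.trans_le (min_le_right _ _)).ne)

/-! ### Integrals along the contour -/

lemma integrable_of_bounds {g : ℝ → ℂ} (hg : ContinuousOn g {0}ᶜ) {C C' R δ : ℝ} (hδ : 0 < δ)
    (hinf : ∀ s, R ≤ |s| → ‖g s‖ ≤ C / s ^ 2) (hzero : ∀ s, s ≠ 0 → |s| ≤ δ → ‖g s‖ ≤ C') :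
    Integrable g := by
  have hcpt : IsCompact {s : ℝ | δ ≤ |s| ∧ |s| ≤ R} := by
    refine (isCompact_Icc (a := -R) (b := R)).of_isClosed_subset
      ((isClosed_le continuous_const continuous_abs).inter
        (isClosed_le continuous_abs continuous_const)) fun s hs => abs_le.1 hs.2
  obtain ⟨K, hK⟩ := hcpt.exists_bound_of_continuousOn
    (hg.mono fun s hs h0 => by
      have h0 : s = 0 := h0
      have := hs.1
      rw [h0, abs_zero] at this
      linarith)
  -- A multiple of `1 / (1 + s²)` dominates: the three summands serve `|s| ≤ δ`, the compact middle
  -- range, and `|s| ≥ R`, where `(1 + s²) / s² ≤ 1 + δ⁻²` for `|s| > δ`. Absolute values are taken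
  -- since no sign of the constants is known.
  refine Integrable.mono' ((integrable_inv_one_add_sq).const_mul
    (|C'| * (1 + δ ^ 2) + |K| * (1 + R ^ 2) + |C| * (1 + (δ ^ 2)⁻¹))) ?_ ?_
  · have := hg.aestronglyMeasurable (μ := volume) (measurableSet_singleton (0 : ℝ)).compl
    rwa [restrict_compl_singleton] at this
  · have : ∀ᵐ s : ℝ, s ≠ 0 := by simp [ae_iff]
    filter_upwards [this] with s hs
    have hs2 : 0 < 1 + s ^ 2 := by positivity
    rw [← div_eq_mul_inv, le_div_iff₀ hs2]
    have hC := abs_nonneg C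
    have hC' := abs_nonneg C'
    have hK' := abs_nonneg K
    have hδi : 0 < (δ ^ 2)⁻¹ := by positivity
    have p1 : 0 ≤ |C'| * (1 + δ ^ 2) := by positivity
    have p2 : 0 ≤ |K| * (1 + R ^ 2) := by positivity
    have p3 : 0 ≤ |C| * (1 + (δ ^ 2)⁻¹) := by positivity
    by_cases h1 : |s| ≤ δ
    · have hsq : s ^ 2 ≤ δ ^ 2 := by rw [← sq_abs s]; gcongr
      have : ‖g s‖ * (1 + s ^ 2) ≤ |C'| * (1 + δ ^ 2) :=
        mul_le_mul ((hzero s hs h1).trans (le_abs_self _)) (by linarith) hs2.le hC'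
      linarith
    · push Not at h1
      by_cases h2 : R ≤ |s|
      · have hss : 0 < s ^ 2 := by positivity
        have hsq : δ ^ 2 ≤ s ^ 2 := by rw [← sq_abs s]; gcongr
        have : ‖g s‖ * (1 + s ^ 2) ≤ |C| / s ^ 2 * (1 + s ^ 2) := by
          gcongr
          exact (hinf s h2).trans (by gcongr; exact le_abs_self C)
        have e : |C| / s ^ 2 * (1 + s ^ 2) = |C| * (1 + (s ^ 2)⁻¹) := by field_simp; ring
        have : |C| * (1 + (s ^ 2)⁻¹) ≤ |C| * (1 + (δ ^ 2)⁻¹) := by gcongr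
        linarith
      · push Not at h2
        have hsq : s ^ 2 ≤ R ^ 2 := by rw [← sq_abs s]; gcongr
        have : ‖g s‖ * (1 + s ^ 2) ≤ |K| * (1 + R ^ 2) :=
          mul_le_mul ((hK s ⟨h1.le, h2.le⟩).trans (le_abs_self _)) (by linarith) hs2.le hK'
        linarith

lemma continuousOn_arcPullback {r : ℝ} {F : ℂ → ℂ} {E : Set ℂ} {A : Set ℝ}
    (hF : ContinuousOn F E) (hA : ∀ φ ∈ A, (r : ℂ) * exp (φ * I) ∈ E) :
    ContinuousOn (arcPullback r F) A :=
  (hF.comp (f := fun φ : ℝ => (r : ℂ) * exp (φ * I))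
    (by fun_prop) hA).mul (by fun_prop)

/-- On a circle about `0`, `(c/z) dz = c i dφ`, so `-c/z` contributes exactly `-c i` times the
opening angle and the remainder is at most `B` times the arc length. It is used with `B = O(1/R²)`
on large arcs and with `c = 0` on small ones. -/
lemma norm_integral_arcPullback_le {r α β B : ℝ} (hr : 0 < r) (hαβ : α ≤ β) {F : ℂ → ℂ} {c : ℂ}
    {E : Set ℂ} (hF : ContinuousOn F E) (hE : ∀ φ ∈ Set.Icc α β, (r : ℂ) * exp (φ * I) ∈ E)
    (hB : ∀ z ∈ E, ‖z‖ = r → ‖F z + c / z‖ ≤ B) :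
    ‖(∫ φ in α..β, arcPullback r F φ) + c * I * ((β : ℂ) - α)‖ ≤ B * r * (β - α) := by
  have hi : IntervalIntegrable (arcPullback r F) volume α β :=
    (continuousOn_arcPullback hF (by rwa [Set.uIcc_of_le hαβ])).intervalIntegrable
  have e : (∫ φ in α..β, arcPullback r F φ) + c * I * ((β : ℂ) - α)
      = ∫ φ in α..β, (arcPullback r F φ + c * I) := by
    rw [intervalIntegral.integral_add hi intervalIntegrable_const, intervalIntegral.integral_const]
    simp [mul_comm]
  rw [e, ← abs_of_nonneg (sub_nonneg.2 hαβ)]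
  refine intervalIntegral.norm_integral_le_of_norm_le_const fun φ hφ => ?_
  rw [Set.uIoc_of_le hαβ] at hφ
  have hz := hE φ ⟨hφ.1.le, hφ.2⟩
  have hn : ‖(r : ℂ) * exp (φ * I)‖ = r := by
    rw [norm_mul, norm_exp_ofReal_mul_I, norm_real, Real.norm_of_nonneg hr.le, mul_one]
  have hz0 : (r : ℂ) * exp (φ * I) ≠ 0 := by rw [← norm_pos_iff, hn]; exact hr
  have e2 : arcPullback r F φ + c * I = (F ((r : ℂ) * exp (φ * I)) + c / ((r : ℂ) * exp (φ * I)))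
      * ((r : ℂ) * exp (φ * I) * I) := by
    rw [add_mul, arcPullback]
    congr 1
    · ring
    · rw [div_mul_eq_mul_div, eq_div_iff hz0]; ring
  rw [e2, norm_mul, norm_mul, hn, norm_I, mul_one]
  gcongr
  exact hB _ hz hn

/-! ### The contour integral of the jump of a sectionally holomorphic function -/

lemma norm_ofReal_mul_exp {r : ℝ} (hr : 0 < r) (φ : ℝ) : ‖(r : ℂ) * exp (φ * I)‖ = r := by
  rw [norm_mul, norm_exp_ofReal_mul_I, norm_real, Real.norm_of_nonneg hr.le, mul_one]

lemma im_ofReal_mul_exp (r φ : ℝ) : ((r : ℂ) * exp (φ * I)).im = r * Real.sin φ := by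
  rw [im_ofReal_mul, exp_ofReal_mul_I_im]

lemma ofReal_mem_Spec_diff {k₀ s : ℝ} (hs : s ≠ 0) : (s : ℂ) ∈ Spec k₀ \ {0} :=
  ⟨ofReal_mem_Spec k₀ s, by simpa using hs⟩

lemma circle_mem_Spec {k₀ : ℝ} (hk₀ : 0 < k₀) (φ : ℝ) :
    (k₀ : ℂ) * exp (φ * I) ∈ Spec k₀ \ {0} :=
  ⟨Or.inr (norm_ofReal_mul_exp hk₀ φ), by simp [hk₀.ne']⟩

section Jump

variable {k₀ : ℝ} {Fp Fm J : ℂ → ℂ}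

lemma continuousOn_jump (cp : ContinuousOn Fp (Dplus k₀ ∪ (Spec k₀ \ {0})))
    (cm : ContinuousOn Fm (Dminus k₀ ∪ (Spec k₀ \ {0})))
    (hJ : ∀ z ∈ Spec k₀ \ {0}, J z = Fp z - Fm z) : ContinuousOn J (Spec k₀ \ {0}) :=
  ((cp.mono Set.subset_union_right).sub (cm.mono Set.subset_union_right)).congr hJ

lemma integral_jump_segment {α β : ℝ} (h0 : (0 : ℝ) ∉ Set.uIcc α β)
    (cp : ContinuousOn Fp (Dplus k₀ ∪ (Spec k₀ \ {0})))
    (cm : ContinuousOn Fm (Dminus k₀ ∪ (Spec k₀ \ {0})))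
    (hJ : ∀ z ∈ Spec k₀ \ {0}, J z = Fp z - Fm z) :
    (∫ s in α..β, J (s : ℂ)) = (∫ s in α..β, Fp (s : ℂ)) - ∫ s in α..β, Fm (s : ℂ) := by
  have hmem : ∀ s ∈ Set.uIcc α β, (s : ℂ) ∈ Spec k₀ \ {0} := fun s hs =>
    ofReal_mem_Spec_diff fun h => h0 (h ▸ hs)
  rw [← intervalIntegral.integral_sub]
  · exact intervalIntegral.integral_congr fun s hs => hJ _ (hmem s hs)
  · exact (cp.comp continuous_ofReal.continuousOn
      fun s hs => Or.inr (hmem s hs)).intervalIntegrable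
  · exact (cm.comp continuous_ofReal.continuousOn
      fun s hs => Or.inr (hmem s hs)).intervalIntegrable

lemma integral_jump_arc (hk₀ : 0 < k₀) (α β : ℝ)
    (cp : ContinuousOn Fp (Dplus k₀ ∪ (Spec k₀ \ {0})))
    (cm : ContinuousOn Fm (Dminus k₀ ∪ (Spec k₀ \ {0})))
    (hJ : ∀ z ∈ Spec k₀ \ {0}, J z = Fp z - Fm z) :
    (∫ φ in α..β, arcPullback k₀ J φ)
      = (∫ φ in α..β, arcPullback k₀ Fp φ) - ∫ φ in α..β, arcPullback k₀ Fm φ := by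
  rw [← intervalIntegral.integral_sub]
  · refine intervalIntegral.integral_congr fun φ _ => ?_
    simp only [arcPullback]
    rw [hJ _ (circle_mem_Spec hk₀ φ), sub_mul]
  · exact (continuousOn_arcPullback cp
      fun φ _ => Or.inr (circle_mem_Spec hk₀ φ)).intervalIntegrable
  · exact (continuousOn_arcPullback cm
      fun φ _ => Or.inr (circle_mem_Spec hk₀ φ)).intervalIntegrable

/-- Outside the circle the upper half annulus lies in `D⁺` and the lower one in `D⁻`. Their
boundaries traverse the real segments in opposite directions, so the sum of the two Cauchy
identities sees only the jump there. -/
lemma exterior_identity (hk₀ : 0 < k₀) {R : ℝ} (hR : k₀ ≤ R)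
    (dp : DifferentiableOn ℂ Fp (Dplus k₀)) (dm : DifferentiableOn ℂ Fm (Dminus k₀))
    (cp : ContinuousOn Fp (Dplus k₀ ∪ (Spec k₀ \ {0})))
    (cm : ContinuousOn Fm (Dminus k₀ ∪ (Spec k₀ \ {0})))
    (hJ : ∀ z ∈ Spec k₀ \ {0}, J z = Fp z - Fm z) :
    (∫ s in k₀..R, J (s : ℂ)) + (∫ s in (-R)..(-k₀), J (s : ℂ))
      + ((∫ φ in (0 : ℝ)..Real.pi, arcPullback R Fp φ) + ∫ φ in (-Real.pi)..0, arcPullback R Fm φ)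
      = (∫ φ in (0 : ℝ)..Real.pi, arcPullback k₀ Fp φ)
        + ∫ φ in (-Real.pi)..0, arcPullback k₀ Fm φ := by
  have h1 := integral_upper_half_annulus (F := Fp) hk₀ hR
    (cp.mono fun z hz => mem_Dplus_union hk₀ (norm_pos_iff.1 (hk₀.trans_le hz.1))
      (mul_nonneg (sub_nonneg.2 (pow_le_pow_left₀ hk₀.le hz.1 2)) hz.2.2))
    (dp.mono fun z hz => mem_Dplus_iff.2
      (mul_pos (sub_pos.2 (pow_lt_pow_left₀ hz.1 hk₀.le two_ne_zero)) hz.2.2))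
  have h2 := integral_lower_half_annulus (F := Fm) hk₀ hR
    (cm.mono fun z hz => mem_Dminus_union hk₀ (norm_pos_iff.1 (hk₀.trans_le hz.1))
      (mul_nonpos_of_nonneg_of_nonpos (sub_nonneg.2 (pow_le_pow_left₀ hk₀.le hz.1 2)) hz.2.2))
    (dm.mono fun z hz => mem_Dminus_iff.2
      (mul_neg_of_pos_of_neg (sub_pos.2 (pow_lt_pow_left₀ hz.1 hk₀.le two_ne_zero)) hz.2.2))
  rw [integral_jump_segment (α := k₀) (β := R) ?_ cp cm hJ,
    integral_jump_segment (α := -R) (β := -k₀) ?_ cp cm hJ]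
  · linear_combination h1 + h2
  · rw [Set.uIcc_of_le (by linarith)]; exact fun h => by linarith [h.2]
  · rw [Set.uIcc_of_le (by linarith)]; exact fun h => by linarith [h.1]

/-- Inside the circle `D⁺` and `D⁻` trade places, which reverses the sign with which the jump enters
and matches the reversed orientation of `[-k₀, k₀]`. -/
lemma interior_identity (hk₀ : 0 < k₀) {r : ℝ} (hr : 0 < r) (hrk : r ≤ k₀)
    (dp : DifferentiableOn ℂ Fp (Dplus k₀)) (dm : DifferentiableOn ℂ Fm (Dminus k₀))
    (cp : ContinuousOn Fp (Dplus k₀ ∪ (Spec k₀ \ {0})))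
    (cm : ContinuousOn Fm (Dminus k₀ ∪ (Spec k₀ \ {0})))
    (hJ : ∀ z ∈ Spec k₀ \ {0}, J z = Fp z - Fm z) :
    (∫ s in r..k₀, J (s : ℂ)) + (∫ s in (-k₀)..(-r), J (s : ℂ))
      + ((∫ φ in (0 : ℝ)..Real.pi, arcPullback r Fm φ) + ∫ φ in (-Real.pi)..0, arcPullback r Fp φ)
      = (∫ φ in (0 : ℝ)..Real.pi, arcPullback k₀ Fm φ)
        + ∫ φ in (-Real.pi)..0, arcPullback k₀ Fp φ := by
  have h1 := integral_upper_half_annulus (F := Fm) hr hrk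
    (cm.mono fun z hz => mem_Dminus_union hk₀ (norm_pos_iff.1 (hr.trans_le hz.1))
      (mul_nonpos_of_nonpos_of_nonneg
        (sub_nonpos.2 (pow_le_pow_left₀ (norm_nonneg z) hz.2.1 2)) hz.2.2))
    (dm.mono fun z hz => mem_Dminus_iff.2
      (mul_neg_of_neg_of_pos
        (sub_neg.2 (pow_lt_pow_left₀ hz.2.1 (norm_nonneg z) two_ne_zero)) hz.2.2))
  have h2 := integral_lower_half_annulus (F := Fp) hr hrk
    (cp.mono fun z hz => mem_Dplus_union hk₀ (norm_pos_iff.1 (hr.trans_le hz.1))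
      (mul_nonneg_of_nonpos_of_nonpos
        (sub_nonpos.2 (pow_le_pow_left₀ (norm_nonneg z) hz.2.1 2)) hz.2.2))
    (dp.mono fun z hz => mem_Dplus_iff.2
      (mul_pos_of_neg_of_neg
        (sub_neg.2 (pow_lt_pow_left₀ hz.2.1 (norm_nonneg z) two_ne_zero)) hz.2.2))
  rw [integral_jump_segment (α := r) (β := k₀) ?_ cp cm hJ,
    integral_jump_segment (α := -k₀) (β := -r) ?_ cp cm hJ]
  · linear_combination -h1 - h2
  · rw [Set.uIcc_of_le (by linarith)]; exact fun h => by linarith [h.2]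
  · rw [Set.uIcc_of_le (by linarith)]; exact fun h => by linarith [h.1]

/-- If `F±` is holomorphic in `D±`, continuous up to `Σ ∖ {0}`, equal to `-c/z + O(1/z²)` at
infinity and bounded at `0`, then the jump `F⁺ - F⁻` is absolutely integrable along `Σ`, with
integral `2πi c`. -/
theorem specIntegral_jump (hk₀ : 0 < k₀) {c : ℂ}
    (dp : DifferentiableOn ℂ Fp (Dplus k₀)) (dm : DifferentiableOn ℂ Fm (Dminus k₀))
    (cp : ContinuousOn Fp (Dplus k₀ ∪ (Spec k₀ \ {0})))
    (cm : ContinuousOn Fm (Dminus k₀ ∪ (Spec k₀ \ {0})))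
    (ip : (fun z => Fp z + c / z) =O[Bornology.cobounded ℂ ⊓ 𝓟 (Dplus k₀)] (fun z => (z ^ 2)⁻¹))
    (im : (fun z => Fm z + c / z) =O[Bornology.cobounded ℂ ⊓ 𝓟 (Dminus k₀)] (fun z => (z ^ 2)⁻¹))
    (zp : Fp =O[𝓝[Dplus k₀] 0] (fun _ => (1 : ℂ))) (zm : Fm =O[𝓝[Dminus k₀] 0] (fun _ => (1 : ℂ)))
    (hJ : ∀ z ∈ Spec k₀ \ {0}, J z = Fp z - Fm z) :
    IntegrableOnSpec k₀ J ∧ specIntegral k₀ J = 2 * Real.pi * I * c := by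
  have hp0 : (0 : ℂ) ∉ Dplus k₀ ∪ (Spec k₀ \ {0}) := by simp [mem_Dplus_iff]
  have hm0 : (0 : ℂ) ∉ Dminus k₀ ∪ (Spec k₀ \ {0}) := by simp [mem_Dminus_iff]
  have hclp : ∀ z ∈ Dplus k₀ ∪ (Spec k₀ \ {0}), ‖z‖ ≠ k₀ → z ∈ closure (Dplus k₀) := by
    rintro z (hz | ⟨hz | hz, -⟩) hn
    · exact subset_closure hz
    · exact mem_closure_Dplus hk₀ hz hn
    · exact absurd hz hn
  have hclm : ∀ z ∈ Dminus k₀ ∪ (Spec k₀ \ {0}), ‖z‖ ≠ k₀ → z ∈ closure (Dminus k₀) := by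
    rintro z (hz | ⟨hz | hz, -⟩) hn
    · exact subset_closure hz
    · exact mem_closure_Dminus hk₀ hz hn
    · exact absurd hz hn
  obtain ⟨Cp, Rp, hRp, hCp⟩ :=
    exists_bound_cobounded hk₀ Set.subset_union_left hclp hp0 cp ip
  obtain ⟨Cm, Rm, hRm, hCm⟩ :=
    exists_bound_cobounded hk₀ Set.subset_union_left hclm hm0 cm im
  obtain ⟨Bp, δp, hδp, hδpk, hBp⟩ := exists_bound_zero hk₀ Set.subset_union_left hclp cp zp
  obtain ⟨Bm, δm, hδm, hδmk, hBm⟩ := exists_bound_zero hk₀ Set.subset_union_left hclm cm zm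
  have cJ := continuousOn_jump cp cm hJ
  have hreal : Integrable (fun s : ℝ => J (s : ℂ)) := by
    refine integrable_of_bounds (C := Cp + Cm) (C' := Bp + Bm) (R := max Rp Rm)
      (δ := min δp δm) (cJ.comp continuous_ofReal.continuousOn
        fun s hs => ofReal_mem_Spec_diff hs) (lt_min hδp hδm) ?_ ?_
    · intro s hs
      have hs0 : s ≠ 0 := by
        rintro rfl
        have := (le_max_left Rp Rm).trans hs
        rw [abs_zero] at this
        linarith
      have hm := ofReal_mem_Spec_diff (k₀ := k₀) hs0
      have h1 := hCp s (Or.inr hm) (by simpa using (le_max_left _ _).trans hs)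
      have h2 := hCm s (Or.inr hm) (by simpa using (le_max_right _ _).trans hs)
      simp only [norm_real, Real.norm_eq_abs, sq_abs] at h1 h2
      -- The tails `-c/z` of the two branches cancel in the jump, leaving `O(1/s²)`.
      rw [hJ _ hm, add_div, show Fp s - Fm s = (Fp s + c / s) - (Fm s + c / s) by ring]
      exact (norm_sub_le _ _).trans (add_le_add h1 h2)
    · intro s hs0 hs
      have hm := ofReal_mem_Spec_diff (k₀ := k₀) hs0
      rw [hJ _ hm]
      exact (norm_sub_le _ _).trans (add_le_add
        (hBp s (Or.inr hm) (by simpa using hs.trans (min_le_left _ _)))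
        (hBm s (Or.inr hm) (by simpa using hs.trans (min_le_right _ _))))
  have hcirc : IntegrableOn (arcPullback k₀ J) (Set.Ioc (-Real.pi) Real.pi) :=
    ((continuousOn_arcPullback cJ fun φ _ => circle_mem_Spec hk₀ φ).integrableOn_Icc).mono_set
      Set.Ioc_subset_Icc_self
  have hext : (∫ s in Set.Ici k₀, J (s : ℂ)) + (∫ s in Set.Iic (-k₀), J (s : ℂ))
      + -(2 * Real.pi * I * c) = (∫ φ in (0 : ℝ)..Real.pi, arcPullback k₀ Fp φ)
        + ∫ φ in (-Real.pi)..0, arcPullback k₀ Fm φ := by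
    -- Each large half circle contributes `-π i c` in the limit.
    have hout : Tendsto (fun R : ℝ => (∫ φ in (0 : ℝ)..Real.pi, arcPullback R Fp φ)
        + ∫ φ in (-Real.pi)..0, arcPullback R Fm φ) atTop (𝓝 (-(2 * Real.pi * I * c))) := by
      rw [tendsto_iff_norm_sub_tendsto_zero]
      have hlim : Tendsto (fun R : ℝ => (Cp + Cm) * Real.pi * R⁻¹) atTop (𝓝 0) := by
        simpa using tendsto_inv_atTop_zero.const_mul ((Cp + Cm) * Real.pi)
      refine squeeze_zero' (Eventually.of_forall fun _ => norm_nonneg _) ?_ hlim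
      filter_upwards [eventually_ge_atTop (max Rp Rm)] with R hR
      have hRp' : Rp ≤ R := (le_max_left _ _).trans hR
      have hRm' : Rm ≤ R := (le_max_right _ _).trans hR
      have hkR : k₀ < R := hRp.trans_le hRp'
      have hR0 : 0 < R := hk₀.trans hkR
      have hsq : 0 ≤ R ^ 2 - k₀ ^ 2 := sub_nonneg.2 (pow_le_pow_left₀ hk₀.le hkR.le 2)
      have b1 := norm_integral_arcPullback_le (α := 0) (β := Real.pi) (B := Cp / R ^ 2) (c := c)
        hR0 Real.pi_pos.le cp (fun φ hφ => mem_Dplus_union hk₀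
          (by rw [← norm_pos_iff, norm_ofReal_mul_exp hR0]; exact hR0)
          (by
            rw [norm_ofReal_mul_exp hR0, im_ofReal_mul_exp]
            exact mul_nonneg hsq (mul_nonneg hR0.le (Real.sin_nonneg_of_nonneg_of_le_pi hφ.1 hφ.2))))
        (fun z hz hn => hn ▸ hCp z hz (hn ▸ hRp'))
      have b2 := norm_integral_arcPullback_le (α := -Real.pi) (β := 0) (B := Cm / R ^ 2) (c := c)
        hR0 (by linarith [Real.pi_pos]) cm (fun φ hφ => mem_Dminus_union hk₀
          (by rw [← norm_pos_iff, norm_ofReal_mul_exp hR0]; exact hR0)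
          (by
            rw [norm_ofReal_mul_exp hR0, im_ofReal_mul_exp]
            exact mul_nonpos_of_nonneg_of_nonpos hsq (mul_nonpos_of_nonneg_of_nonpos hR0.le
              (Real.sin_nonpos_of_nonpos_of_neg_pi_le hφ.2 hφ.1))))
        (fun z hz hn => hn ▸ hCm z hz (hn ▸ hRm'))
      have e := (norm_add_le _ _).trans (add_le_add b1 b2)
      refine le_of_eq_of_le ?_ (e.trans_eq ?_)
      · congr 1; push_cast; ring
      · field_simp; ring
    have h1 := intervalIntegral_tendsto_integral_Ioi k₀ hreal.integrableOn (tendsto_id (α := ℝ))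
    have h2 := intervalIntegral_tendsto_integral_Iic (-k₀) hreal.integrableOn tendsto_neg_atTop_atBot
    rw [integral_Ici_eq_integral_Ioi]
    refine tendsto_nhds_unique ((h1.add h2).add hout) (tendsto_const_nhds.congr' ?_)
    filter_upwards [eventually_ge_atTop k₀] with R hR
    exact (exterior_identity hk₀ hR dp dm cp cm hJ).symm
  have hint : (∫ s in (-k₀)..k₀, J (s : ℂ)) = (∫ φ in (0 : ℝ)..Real.pi, arcPullback k₀ Fm φ)
        + ∫ φ in (-Real.pi)..0, arcPullback k₀ Fp φ := by
    -- Bounded integrands on arcs of length `π r` disappear as `r → 0`.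
    have hin : Tendsto (fun r : ℝ => (∫ φ in (0 : ℝ)..Real.pi, arcPullback r Fm φ)
        + ∫ φ in (-Real.pi)..0, arcPullback r Fp φ) (𝓝[>] 0) (𝓝 0) := by
      rw [tendsto_zero_iff_norm_tendsto_zero]
      have hlim : Tendsto (fun r : ℝ => (Bp + Bm) * Real.pi * r) (𝓝[>] 0) (𝓝 0) := by
        have : Continuous (fun r : ℝ => (Bp + Bm) * Real.pi * r) := by fun_prop
        simpa using (this.tendsto 0).mono_left nhdsWithin_le_nhds
      refine squeeze_zero' (Eventually.of_forall fun _ => norm_nonneg _) ?_ hlim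
      filter_upwards [Ioc_mem_nhdsGT (lt_min hδp hδm)] with r hr
      have hr0 : 0 < r := hr.1
      have hrp : r ≤ δp := hr.2.trans (min_le_left _ _)
      have hrm : r ≤ δm := hr.2.trans (min_le_right _ _)
      have hsq : r ^ 2 - k₀ ^ 2 ≤ 0 :=
        sub_nonpos.2 (pow_le_pow_left₀ hr0.le (hrp.trans hδpk.le) 2)
      have b1 := norm_integral_arcPullback_le (α := 0) (β := Real.pi) (B := Bm) (c := 0)
        hr0 Real.pi_pos.le cm (fun φ hφ => mem_Dminus_union hk₀
          (by rw [← norm_pos_iff, norm_ofReal_mul_exp hr0]; exact hr0)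
          (by
            rw [norm_ofReal_mul_exp hr0, im_ofReal_mul_exp]
            exact mul_nonpos_of_nonpos_of_nonneg hsq
              (mul_nonneg hr0.le (Real.sin_nonneg_of_nonneg_of_le_pi hφ.1 hφ.2))))
        (fun z hz hn => by simpa using hBm z hz (hn ▸ hrm))
      have b2 := norm_integral_arcPullback_le (α := -Real.pi) (β := 0) (B := Bp) (c := 0)
        hr0 (by linarith [Real.pi_pos]) cp (fun φ hφ => mem_Dplus_union hk₀
          (by rw [← norm_pos_iff, norm_ofReal_mul_exp hr0]; exact hr0)
          (by
            rw [norm_ofReal_mul_exp hr0, im_ofReal_mul_exp]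
            exact mul_nonneg_of_nonpos_of_nonpos hsq (mul_nonpos_of_nonneg_of_nonpos hr0.le
              (Real.sin_nonpos_of_nonpos_of_neg_pi_le hφ.2 hφ.1))))
        (fun z hz hn => by simpa using hBp z hz (hn ▸ hrp))
      have e := (norm_add_le _ _).trans (add_le_add b1 b2)
      refine le_of_eq_of_le ?_ (e.trans_eq ?_)
      · congr 1; push_cast; ring
      · ring
    have hii : ∀ α β : ℝ, IntervalIntegrable (fun s : ℝ => J (s : ℂ)) volume α β :=
      fun α β => hreal.intervalIntegrable
    have h1 : Tendsto (fun r : ℝ => ∫ s in r..k₀, J (s : ℂ)) (𝓝[>] 0)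
        (𝓝 (∫ s in (0 : ℝ)..k₀, J (s : ℂ))) := by
      have := ((intervalIntegral.continuous_primitive hii k₀).neg.tendsto 0).mono_left
        (nhdsWithin_le_nhds (s := Set.Ioi 0))
      refine (this.congr fun r => ?_).trans (le_of_eq ?_)
      · exact (intervalIntegral.integral_symm k₀ r).symm
      · exact congrArg 𝓝 (intervalIntegral.integral_symm k₀ 0).symm
    have h2 : Tendsto (fun r : ℝ => ∫ s in (-k₀)..(-r), J (s : ℂ)) (𝓝[>] 0)
        (𝓝 (∫ s in (-k₀)..0, J (s : ℂ))) := by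
      have := (((intervalIntegral.continuous_primitive hii (-k₀)).comp
        continuous_neg).tendsto 0).mono_left (nhdsWithin_le_nhds (s := Set.Ioi 0))
      simpa [Function.comp_def] using this
    rw [← intervalIntegral.integral_add_adjacent_intervals (hii (-k₀) 0) (hii 0 k₀),
      add_comm, ← add_zero (_ + _)]
    refine tendsto_nhds_unique ((h1.add h2).add hin) (tendsto_const_nhds.congr' ?_)
    filter_upwards [Ioc_mem_nhdsGT hk₀] with r hr
    exact (interior_identity hk₀ hr.1 hr.2 dp dm cp cm hJ).symm
  refine ⟨⟨hreal, hcirc⟩, ?_⟩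
  have a1 := integral_jump_arc hk₀ 0 Real.pi cp cm hJ
  have a2 := integral_jump_arc hk₀ (-Real.pi) 0 cp cm hJ
  rw [specIntegral, intervalIntegral.integral_symm (-k₀) k₀,
    intervalIntegral.integral_symm 0 Real.pi]
  -- Subtracting the interior from the exterior identity turns the arcs `|z| = k₀` into the jump,
  -- with sign plus on the upper and minus on the lower half; this is the orientation from `-k₀` to
  -- `k₀`.
  linear_combination hext - hint - a1 + a2

end Jump

/-! ### Removable singularities and the Cauchy quotient -/

/-- Only finitely many values are altered, all inside `U`, so near a point of `T` the extension
agrees with `f` and continuity up to `T` survives. -/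
lemma exists_removable_extension {U T S : Set ℂ} {f : ℂ → ℂ} (hU : IsOpen U) (hUT : Disjoint U T)
    (hS : S.Finite) (hd : DifferentiableOn ℂ f (U \ S))
    (hrem : ∀ s ∈ S ∩ U, ∃ g : ℂ → ℂ, AnalyticAt ℂ g s ∧ ∀ᶠ z in 𝓝[≠] s, f z = g z)
    (hc : ContinuousOn f ((U \ S) ∪ T)) :
    ∃ F : ℂ → ℂ, DifferentiableOn ℂ F U ∧ ContinuousOn F (U ∪ T) ∧
      ∀ z, z ∉ S ∩ U → F z = f z := by
  classical
  choose! g hg hfg using hrem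
  have hSf : (S ∩ U).Finite := hS.subset Set.inter_subset_left
  -- `g z` is the analytic germ chosen at `z`; only its value at its own base point is used.
  set F : ℂ → ℂ := fun z => if z ∈ S ∩ U then g z z else f z with hF
  have hFf : ∀ z, z ∉ S ∩ U → F z = f z := fun z hz => by simp only [hF, if_neg hz]
  have hdF : DifferentiableOn ℂ F U := by
    intro z hz
    refine DifferentiableAt.differentiableWithinAt ?_
    by_cases hzS : z ∈ S
    · refine (hg z ⟨hzS, hz⟩).differentiableAt.congr_of_eventuallyEq ?_
      have hother : ∀ᶠ u in 𝓝 z, u ∉ (S ∩ U) \ {z} :=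
        (hSf.subset Set.sdiff_subset).isClosed.isOpen_compl.mem_nhds (by simp)
      filter_upwards [hother, eventually_nhdsWithin_iff.1 (hfg z ⟨hzS, hz⟩)] with u h1 h2
      by_cases huz : u = z
      · subst huz
        simp only [hF, if_pos (show u ∈ S ∩ U from ⟨hzS, hz⟩)]
      · rw [hFf u fun h => h1 ⟨h, huz⟩, h2 huz]
    · have hopen : IsOpen (U \ S) := hU.sdiff hS.isClosed
      refine (hd.differentiableAt (hopen.mem_nhds ⟨hz, hzS⟩)).congr_of_eventuallyEq ?_
      filter_upwards [hopen.mem_nhds ⟨hz, hzS⟩] with u hu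
      exact hFf u fun h => hu.2 h.1
  refine ⟨F, hdF, ?_, hFf⟩
  rintro z (hz | hz)
  · exact (hdF.differentiableAt (hU.mem_nhds hz)).continuousAt.continuousWithinAt
  · have hzS : z ∉ S ∩ U := fun h => Set.disjoint_left.1 hUT h.2 hz
    have h1 : ContinuousWithinAt F ((U \ S) ∪ T) z := by
      refine (hc z (Or.inr hz)).congr (fun u hu => hFf u ?_) (hFf z hzS)
      rintro ⟨huS, huU⟩
      rcases hu with hu | hu
      · exact hu.2 huS
      · exact Set.disjoint_left.1 hUT huU hu
    refine h1.mono_of_mem_nhdsWithin ?_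
    filter_upwards [self_mem_nhdsWithin,
      mem_nhdsWithin_of_mem_nhds (hSf.isClosed.isOpen_compl.mem_nhds hzS)] with u hu huS
    rcases hu with hu | hu
    · exact Or.inl ⟨hu, fun h => huS ⟨h, hu⟩⟩
    · exact Or.inr hu

lemma analyticAt_dslope {h : ℂ → ℂ} {c : ℂ} (hh : AnalyticAt ℂ h c) :
    AnalyticAt ℂ (dslope h c) c := by
  obtain ⟨p, hp⟩ := hh
  exact hp.has_fpower_series_dslope_fslope.analyticAt

/-- The rational function `e - (i/z) B + ∑ r_k / (z - p_k)`. -/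
noncomputable def principalPart {K : Type} (s : Finset K) (e B : ℂ) (p r : K → ℂ) (z : ℂ) : ℂ :=
  e - I / z * B + ∑ k ∈ s, (z - p k)⁻¹ * r k

section PrincipalPart

variable {K : Type} {s : Finset K} {e B : ℂ} {p r : K → ℂ}

lemma analyticAt_principalPart {z : ℂ} (h0 : z ≠ 0) (hp : ∀ k ∈ s, z ≠ p k) :
    AnalyticAt ℂ (principalPart s e B p r) z := by
  refine AnalyticAt.add (analyticAt_const.sub ((analyticAt_const.div analyticAt_id h0).mul
    analyticAt_const)) (Finset.analyticAt_fun_sum _ fun k hk => AnalyticAt.mul ?_ analyticAt_const)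
  exact (analyticAt_id.sub analyticAt_const).inv (sub_ne_zero.2 (hp k hk))

lemma isBigO_inv_sub_cobounded (w : ℂ) :
    (fun z : ℂ => (z - w)⁻¹) =O[Bornology.cobounded ℂ] (fun z => z⁻¹) := by
  refine Asymptotics.IsBigO.of_bound 2 ?_
  have : ∀ᶠ z : ℂ in Bornology.cobounded ℂ, 2 * ‖w‖ + 1 ≤ ‖z‖ := by
    rw [← comap_norm_atTop]
    exact (eventually_ge_atTop _).comap _
  filter_upwards [this] with z hz
  have hw := norm_nonneg w
  have h1 : ‖z‖ - ‖w‖ ≤ ‖z - w‖ := norm_sub_norm_le z w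
  have h2 : 0 < ‖z‖ := by linarith
  have h3 : ‖z‖ / 2 ≤ ‖z - w‖ := by linarith
  rw [norm_inv, norm_inv, show 2 * ‖z‖⁻¹ = (‖z‖ / 2)⁻¹ by field_simp]
  exact inv_anti₀ (by positivity) h3

lemma isBigO_principalPart_sub_cobounded :
    (fun z => principalPart s e B p r z - e) =O[Bornology.cobounded ℂ] (fun z => z⁻¹) := by
  have h1 : (fun z : ℂ => -(I * B) * z⁻¹) =O[Bornology.cobounded ℂ] (fun z => z⁻¹) :=
    (Asymptotics.isBigO_refl _ _).const_mul_left _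
  have h2 : (fun z => ∑ k ∈ s, (z - p k)⁻¹ * r k) =O[Bornology.cobounded ℂ] (fun z => z⁻¹) := by
    refine Asymptotics.IsBigO.fun_sum fun k _ => ?_
    simpa only [mul_comm] using (isBigO_inv_sub_cobounded (p k)).const_mul_left (r k)
  refine (h1.add h2).congr_left fun z => ?_
  rw [principalPart]; ring

lemma isBigO_principalPart_add_zero (hp : ∀ k ∈ s, p k ≠ 0) :
    (fun z => principalPart s e B p r z + I / z * B) =O[𝓝 0] (fun _ => (1 : ℂ)) := by
  have h : ContinuousAt (fun z => e + ∑ k ∈ s, (z - p k)⁻¹ * r k) 0 := by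
    refine ContinuousAt.add continuousAt_const (tendsto_finsetSum _ fun k hk => ?_)
    refine ContinuousAt.mul (ContinuousAt.inv₀ (by fun_prop) ?_) continuousAt_const
    simpa using hp k hk
  refine (h.isBigO_one ℂ).congr_left fun z => ?_
  rw [principalPart]; ring

/-- The quotient `(q - P - c) / (z - w)`, `P` the principal part of `q`, extends holomorphically
over the poles of `q` and over `w`. -/
lemma exists_cauchy_quotient [Fintype K] {U T : Set ℂ} (hU : IsOpen U) (hUT : Disjoint U T)
    (hU0 : (0 : ℂ) ∉ U) (hT0 : (0 : ℂ) ∉ T) {q : ℂ → ℂ} {w c : ℂ}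
    (hp : Function.Injective p) (hp0 : ∀ k, p k ≠ 0) (hpT : ∀ k, p k ∉ T)
    (hw0 : w ≠ 0) (hwT : w ∉ T) (hwp : ∀ k, w ≠ p k)
    (hcw : w ∈ U → c = q w - principalPart Finset.univ e B p r w)
    (hd : DifferentiableOn ℂ q (U \ Set.range p))
    (hpole : ∀ k, p k ∈ U → ∃ g : ℂ → ℂ, AnalyticAt ℂ g (p k) ∧
      ∀ᶠ z in 𝓝[≠] p k, q z = g z + (z - p k)⁻¹ * r k)
    (hc : ContinuousOn q ((U \ Set.range p) ∪ T))
    (hinf : (fun z => q z - e) =O[Bornology.cobounded ℂ ⊓ 𝓟 U] (fun z => z⁻¹))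
    (hzero : (fun z => q z + I / z * B) =O[𝓝[U] 0] (fun _ => (1 : ℂ))) :
    ∃ F : ℂ → ℂ, DifferentiableOn ℂ F U ∧ ContinuousOn F (U ∪ T) ∧
      (fun z => F z + c / z) =O[Bornology.cobounded ℂ ⊓ 𝓟 U] (fun z => (z ^ 2)⁻¹) ∧
      F =O[𝓝[U] 0] (fun _ => (1 : ℂ)) ∧
      ∀ z ∈ T, F z = (z - w)⁻¹ * (q z - principalPart Finset.univ e B p r z - c) := by
  classical
  set P := principalPart Finset.univ e B p r with hP
  set f : ℂ → ℂ := fun z => (z - w)⁻¹ * (q z - P z - c) with hf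
  have hrange : (Set.range p).Finite := Set.finite_range p
  have hS : (insert w (Set.range p)).Finite := hrange.insert w
  have hPan : ∀ z, z ≠ 0 → z ∉ Set.range p → AnalyticAt ℂ P z := fun z h0 hz =>
    analyticAt_principalPart h0 fun k _ h => hz ⟨k, h.symm⟩
  have hinvan : ∀ z, z ≠ w → AnalyticAt ℂ (fun z : ℂ => (z - w)⁻¹) z := fun z hz =>
    (analyticAt_id.sub analyticAt_const).inv (sub_ne_zero.2 hz)
  have hdf : DifferentiableOn ℂ f (U \ insert w (Set.range p)) := by
    intro z hz
    have hzw : z ≠ w := fun h => hz.2 (Or.inl h)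
    have hzp : z ∉ Set.range p := fun h => hz.2 (Or.inr h)
    have hz0 : z ≠ 0 := fun h => hU0 (h ▸ hz.1)
    have hq : DifferentiableAt ℂ q z :=
      hd.differentiableAt ((hU.sdiff hrange.isClosed).mem_nhds ⟨hz.1, hzp⟩)
    exact ((hinvan z hzw).differentiableAt.mul
      ((hq.sub (hPan z hz0 hzp).differentiableAt).sub_const c)).differentiableWithinAt
  have hcf : ContinuousOn f ((U \ insert w (Set.range p)) ∪ T) := by
    have hsub : (U \ insert w (Set.range p)) ∪ T ⊆ (U \ Set.range p) ∪ T :=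
      Set.union_subset_union_left _ (Set.sdiff_subset_sdiff_right (Set.subset_insert _ _))
    have hne : ∀ z ∈ (U \ insert w (Set.range p)) ∪ T,
        z ≠ w ∧ z ≠ 0 ∧ z ∉ Set.range p := by
      rintro z (hz | hz)
      · exact ⟨fun h => hz.2 (Or.inl h), fun h => hU0 (h ▸ hz.1), fun h => hz.2 (Or.inr h)⟩
      · refine ⟨fun h => hwT (h ▸ hz), fun h => hT0 (h ▸ hz), ?_⟩
        rintro ⟨k, rfl⟩
        exact hpT k hz
    refine ContinuousOn.mul (fun z hz => (hinvan z (hne z hz).1).continuousAt.continuousWithinAt)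
      (((hc.mono hsub).sub fun z hz => ?_).sub continuousOn_const)
    exact (hPan z (hne z hz).2.1 (hne z hz).2.2).continuousAt.continuousWithinAt
  have hrem : ∀ z ∈ insert w (Set.range p) ∩ U, ∃ g : ℂ → ℂ, AnalyticAt ℂ g z ∧
      ∀ᶠ u in 𝓝[≠] z, f u = g u := by
    -- At `w` the numerator vanishes by the choice of `c`, so the quotient is a slope. At `p k` the
    -- polar terms of `q` and `P` cancel, leaving `g` minus the other terms of `P`.
    rintro _ ⟨rfl | ⟨k, rfl⟩, hzU⟩
    · rename_i z
      have hzp : z ∉ Set.range p := by rintro ⟨k, hk⟩; exact hwp k hk.symm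
      have hqa : AnalyticAt ℂ q z :=
        hd.analyticAt ((hU.sdiff hrange.isClosed).mem_nhds ⟨hzU, hzp⟩)
      have hh : AnalyticAt ℂ (fun u => q u - P u - c) z :=
        (hqa.sub (hPan z hw0 hzp)).sub analyticAt_const
      refine ⟨_, analyticAt_dslope hh, ?_⟩
      filter_upwards [self_mem_nhdsWithin] with u hu
      rw [dslope_of_ne _ hu, slope_def_field, hf]
      simp only
      rw [hcw hzU, sub_self, sub_zero, div_eq_inv_mul]
    · obtain ⟨g, hg, hqg⟩ := hpole k hzU
      refine ⟨fun z => (z - w)⁻¹ * (g z - principalPart (Finset.univ.erase k) e B p r z - c),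
        (hinvan _ (hwp k).symm).mul ((hg.sub (analyticAt_principalPart (hp0 k)
          fun j hj h => (Finset.ne_of_mem_erase hj) (hp h).symm)).sub analyticAt_const), ?_⟩
      filter_upwards [hqg] with u hu
      simp only [hf, hP, hu, principalPart]
      rw [← Finset.add_sum_erase Finset.univ (fun k => (u - p k)⁻¹ * r k) (Finset.mem_univ k)]
      ring
  obtain ⟨F, hdF, hcF, hFf⟩ := exists_removable_extension hU hUT hS hdf hrem hcf
  refine ⟨F, hdF, hcF, ?_, ?_, fun z hz => hFf z fun h => Set.disjoint_left.1 hUT h.2 hz⟩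
  · have hle : Bornology.cobounded ℂ ⊓ 𝓟 U ≤ Bornology.cobounded ℂ := inf_le_left
    have h1 := ((isBigO_inv_sub_cobounded w).mono hle).mul
      (hinf.sub ((isBigO_principalPart_sub_cobounded (s := Finset.univ) (e := e) (B := B) (p := p)
        (r := r)).mono hle))
    -- This term arises from `c/z - c/(z - w) = -c w / (z (z - w))`.
    have h2 := (((isBigO_inv_sub_cobounded w).mono hle).mul
      (Asymptotics.isBigO_refl (fun z : ℂ => z⁻¹) _)).const_mul_left (-(c * w))
    refine (h1.add h2).congr' ?_ (Eventually.of_forall fun z => by simp only [pow_two, mul_inv])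
    have hnS : ∀ᶠ z in Bornology.cobounded ℂ ⊓ 𝓟 U, z ∉ insert w (Set.range p) :=
      hle (Bornology.isBounded_def.1 hS.isBounded)
    have hzU : ∀ᶠ z in Bornology.cobounded ℂ ⊓ 𝓟 U, z ∈ U :=
      mem_inf_of_right (mem_principal_self U)
    filter_upwards [hnS, hzU] with z hz hzU
    have hzw : z - w ≠ 0 := sub_ne_zero.2 fun h => hz (Or.inl h)
    have hz0 : z ≠ 0 := fun h => hU0 (h ▸ hzU)
    rw [hFf z fun h => hz h.1]
    simp only [hf, ← hP]
    field_simp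
    ring
  · have hle : 𝓝[U] (0 : ℂ) ≤ 𝓝 0 := nhdsWithin_le_nhds
    have h1 : (fun z : ℂ => (z - w)⁻¹) =O[𝓝[U] 0] (fun _ => (1 : ℂ)) :=
      ((hinvan 0 hw0.symm).continuousAt.isBigO_one ℂ).mono hle
    -- The poles `-(i/z) B` of `q` and `P` at the origin cancel in `q - P`.
    have h2 := (hzero.sub ((isBigO_principalPart_add_zero (s := Finset.univ) (e := e) (B := B)
      (p := p) (r := r) fun k _ => hp0 k).mono hle)).sub
      (Asymptotics.isBigO_refl (fun _ : ℂ => (1 : ℂ)) _ |>.const_mul_left c)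
    refine (h1.mul h2).congr' ?_ (Eventually.of_forall fun z => mul_one 1)
    have hnS : ∀ᶠ z in 𝓝[U] (0 : ℂ), z ∉ insert w (Set.range p) := by
      refine hle (hS.isClosed.isOpen_compl.mem_nhds ?_)
      rintro (h | ⟨k, hk⟩)
      · exact hw0 h.symm
      · exact hp0 k hk
    filter_upwards [hnS] with z hz
    rw [hFf z fun h => hz h.1]
    simp only [hf, ← hP]
    ring

end PrincipalPart

/-! ### Simple poles -/

/-- `f` is holomorphic on `U` except for at most simple poles at the points `p n`. -/
structure HasSimplePoles {ι : Type} (f : ℂ → ℂ) (U : Set ℂ) (p : ι → ℂ) : Prop where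
  differentiableOn : DifferentiableOn ℂ f (U \ Set.range p)
  pole : ∀ n, ∃ g : ℂ → ℂ, AnalyticAt ℂ g (p n) ∧
    ∀ᶠ z in 𝓝[≠] p n, f z = g z + (z - p n)⁻¹ * residue f (p n)

/-- By Cauchy's integral formula the normalised circle integral equals `φ c` for every small radius,
so the limit defining `residue` is that of an eventually constant function. -/
lemma residue_eq_of_simple_pole {f φ : ℂ → ℂ} {c : ℂ} (hφ : AnalyticAt ℂ φ c)
    (hf : ∀ᶠ z in 𝓝[≠] c, f z = (z - c)⁻¹ * φ z) : residue f c = φ c := by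
  have hev := (eventually_nhdsWithin_iff.1 hf).and hφ.eventually_analyticAt
  obtain ⟨ε, hε, hball⟩ := Metric.eventually_nhds_iff.1 hev
  refine Tendsto.limUnder_eq (tendsto_const_nhds.congr' ?_)
  filter_upwards [Ioo_mem_nhdsGT hε] with r hr
  have h1 : (∮ z in C(c, r), f z) = ∮ z in C(c, r), (z - c)⁻¹ • φ z := by
    refine circleIntegral.integral_congr hr.1.le fun z hz => ?_
    have hzr : dist z c = r := hz
    exact (hball (hzr ▸ hr.2)).1 fun h => hr.1.ne' (by rw [← hzr, h, dist_self])
  have h2 : DiffContOnCl ℂ φ (Metric.ball c r) := by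
    refine DifferentiableOn.diffContOnCl fun z hz => ?_
    rw [closure_ball c hr.1.ne'] at hz
    exact (hball ((Metric.mem_closedBall.1 hz).trans_lt hr.2)).2.differentiableAt
      |>.differentiableWithinAt
  rw [h1, h2.circleIntegral_sub_inv_smul (Metric.mem_ball_self hr.1), smul_eq_mul,
    inv_mul_cancel_left₀]
  simp [Real.pi_ne_zero]

lemma exists_simple_pole_decomposition {f φ : ℂ → ℂ} {c : ℂ} (hφ : AnalyticAt ℂ φ c)
    (hf : ∀ᶠ z in 𝓝[≠] c, f z = (z - c)⁻¹ * φ z) :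
    ∃ g : ℂ → ℂ, AnalyticAt ℂ g c ∧
      ∀ᶠ z in 𝓝[≠] c, f z = g z + (z - c)⁻¹ * residue f c := by
  refine ⟨_, analyticAt_dslope hφ, ?_⟩
  filter_upwards [hf, self_mem_nhdsWithin] with z hz hzc
  rw [residue_eq_of_simple_pole hφ hf, hz, dslope_of_ne _ hzc, slope_def_field]
  ring

/-- The holomorphic block columns are treated on the same footing as the meromorphic ones. The
values of `f` at the `p n` are unconstrained, so `f` is written there as `(z - p n)⁻¹` times `(z - p
n) h`, with residue zero. -/
lemma HasSimplePoles.of_differentiableOn {ι : Type} {f h : ℂ → ℂ} {U : Set ℂ} {p : ι → ℂ}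
    [Finite ι] (hU : IsOpen U) (hp : ∀ n, p n ∈ U) (hh : DifferentiableOn ℂ h U)
    (hf : ∀ z ∈ U \ Set.range p, f z = h z) : HasSimplePoles f U p := by
  refine ⟨(hh.mono Set.sdiff_subset).congr hf, fun n => ?_⟩
  refine exists_simple_pole_decomposition (φ := fun z => (z - p n) * h z)
    ((analyticAt_id.sub analyticAt_const).mul (hh.analyticAt (hU.mem_nhds (hp n)))) ?_
  have h1 : ∀ᶠ z in 𝓝 (p n), z ∉ Set.range p \ {p n} :=
    ((Set.finite_range p).subset Set.sdiff_subset).isClosed.isOpen_compl.mem_nhds (by simp)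
  filter_upwards [mem_nhdsWithin_of_mem_nhds h1, mem_nhdsWithin_of_mem_nhds (hU.mem_nhds (hp n)),
    self_mem_nhdsWithin] with z hz hzU hzn
  rw [hf z ⟨hzU, fun h => hz ⟨h, hzn⟩⟩, inv_mul_cancel_left₀ (sub_ne_zero.2 hzn)]

lemma HasSimplePoles.of_div {ι : Type} {f h d : ℂ → ℂ} {U : Set ℂ} {p : ι → ℂ}
    (hU : IsOpen U) (hp : ∀ n, p n ∈ U) (hh : DifferentiableOn ℂ h U) (hd : DifferentiableOn ℂ d U)
    (hdz : ∀ z ∈ U, d z = 0 ↔ ∃ n, z = p n) (hd' : ∀ n, deriv d (p n) ≠ 0)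
    (hf : ∀ z ∈ U, d z ≠ 0 → f z = (d z)⁻¹ * h z) : HasSimplePoles f U p := by
  have hne : ∀ z ∈ U \ Set.range p, d z ≠ 0 := by
    rintro z ⟨hzU, hz⟩ h0
    obtain ⟨n, hn⟩ := (hdz z hzU).1 h0
    exact hz ⟨n, hn.symm⟩
  refine ⟨(((hd.mono Set.sdiff_subset).inv hne).mul (hh.mono Set.sdiff_subset)).congr
    fun z hz => hf z hz.1 (hne z hz), fun n => ?_⟩
  have hda : AnalyticAt ℂ d (p n) := hd.analyticAt (hU.mem_nhds (hp n))
  have hD := analyticAt_dslope hda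
  -- Simplicity of the zero enters here: `d = (z - p n) · dslope d (p n)`, and the second factor
  -- equals the derivative of `d` at `p n`.
  have hDn : dslope d (p n) (p n) ≠ 0 := by rw [dslope_same]; exact hd' n
  have hd0 : d (p n) = 0 := (hdz _ (hp n)).2 ⟨n, rfl⟩
  refine exists_simple_pole_decomposition (φ := fun z => (dslope d (p n) z)⁻¹ * h z)
    ((hD.inv hDn).mul (hh.analyticAt (hU.mem_nhds (hp n)))) ?_
  filter_upwards [mem_nhdsWithin_of_mem_nhds (hD.continuousAt.eventually_ne hDn),
    mem_nhdsWithin_of_mem_nhds (hU.mem_nhds (hp n)), self_mem_nhdsWithin] with z hz hzU hzn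
  have hz' : z - p n ≠ 0 := sub_ne_zero.2 hzn
  have hdz : d z = (z - p n) * dslope d (p n) z := by
    rw [dslope_of_ne _ hzn, slope_def_field, hd0, sub_zero, mul_div_cancel₀ _ hz']
  rw [hf z hzU (by rw [hdz]; exact mul_ne_zero hz' hz), hdz, mul_inv, mul_assoc]

/-! ### Holomorphic matrix functions -/

lemma Holo.det {m : ℕ} {A : ℂ → Mat m} {U : Set ℂ} (hA : Holo A U) :
    DifferentiableOn ℂ (fun z => (A z).det) U := by
  simp only [Matrix.det_apply]
  exact DifferentiableOn.fun_sum fun σ _ => DifferentiableOn.const_smul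
    (DifferentiableOn.fun_finsetProd fun i _ => hA _ _) _

lemma Holo.adjugate {m : ℕ} {A : ℂ → Mat m} {U : Set ℂ} (hA : Holo A U) :
    Holo (fun z => (A z).adjugate) U := by
  intro i j
  simp only [Matrix.adjugate_apply]
  refine Holo.det fun i' j' => ?_
  simp only [Matrix.updateRow_apply]
  split_ifs
  · exact differentiableOn_const _
  · exact hA _ _

lemma Holo.mul {α : Type} {m : ℕ} {W : ℂ → Matrix α (Fin m) ℂ} {A : ℂ → Mat m} {U : Set ℂ}
    (hW : Holo W U) (hA : Holo A U) : Holo (fun z => W z * A z) U := by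
  intro i j
  simp only [Matrix.mul_apply]
  exact DifferentiableOn.fun_sum fun k _ => (hW i k).mul (hA k j)

/-- Since `a⁻¹ = adj a / det a` with `adj a` holomorphic, the poles are governed by the simple zeros
of the determinant alone. -/
lemma HasSimpleZeros.hasSimplePoles_mul_inv {m : ℕ} {ι : Type} {a : ℂ → Mat m} {U : Set ℂ}
    {p : ι → ℂ} (ha : HasSimpleZeros a U p) (hU : IsOpen U) {W : ℂ → BlockCol m} (hW : Holo W U)
    {f : ℂ → ℂ} (i : Fin m ⊕ Fin m) (j : Fin m)
    (hf : ∀ z ∈ U, (a z).det ≠ 0 → f z = (W z * (a z)⁻¹) i j) : HasSimplePoles f U p := by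
  refine HasSimplePoles.of_div hU ha.mem (hW.mul ha.holo.adjugate i j) ha.holo.det ha.zero_iff
    ha.simple fun z hz h0 => ?_
  rw [hf z hz h0, Matrix.inv_def, Ring.inverse_eq_inv', Matrix.mul_smul, Matrix.smul_apply,
    smul_eq_mul]

lemma HasSimpleZeros.hasSimplePoles_holo {m : ℕ} {ι : Type} [Finite ι] {a : ℂ → Mat m} {U : Set ℂ}
    {p : ι → ℂ} (ha : HasSimpleZeros a U p) (hU : IsOpen U) {V : ℂ → BlockCol m} (hV : Holo V U)
    {f : ℂ → ℂ} (i : Fin m ⊕ Fin m) (j : Fin m)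
    (hf : ∀ z ∈ U, (a z).det ≠ 0 → f z = V z i j) : HasSimplePoles f U p := by
  refine HasSimplePoles.of_differentiableOn hU ha.mem (hV i j) fun z hz => hf z hz.1 fun h0 => ?_
  obtain ⟨n, hn⟩ := (ha.zero_iff z hz.1).1 h0
  exact hz.2 ⟨n, hn.symm⟩

/-! ### The representation formula -/

/-- The scalar representation formula: a sectionally meromorphic function with at most simple
poles, normalised at infinity and at `0`, is recovered from its principal parts and its jump. -/
theorem sectional_representation {ι : Type} [Fintype ι] {k₀ : ℝ} (hk₀ : 0 < k₀) {e B w : ℂ}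
    {p p' : ι → ℂ} {qp qm J : ℂ → ℂ} (hp : Function.Injective p) (hp' : Function.Injective p')
    (hpU : ∀ n, p n ∈ Dplus k₀) (hpU' : ∀ n, p' n ∈ Dminus k₀)
    (hw : w ∉ Spec k₀) (hwp : ∀ n, w ≠ p n) (hwp' : ∀ n, w ≠ p' n)
    (sp : HasSimplePoles qp (Dplus k₀) p) (sm : HasSimplePoles qm (Dminus k₀) p')
    (cp : ContinuousOn qp ((Dplus k₀ \ Set.range p) ∪ (Spec k₀ \ {0})))
    (cm : ContinuousOn qm ((Dminus k₀ \ Set.range p') ∪ (Spec k₀ \ {0})))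
    (ip : (fun z => qp z - e) =O[Bornology.cobounded ℂ ⊓ 𝓟 (Dplus k₀)] (fun z => z⁻¹))
    (im : (fun z => qm z - e) =O[Bornology.cobounded ℂ ⊓ 𝓟 (Dminus k₀)] (fun z => z⁻¹))
    (zp : (fun z => qp z + I / z * B) =O[𝓝[Dplus k₀] 0] (fun _ => (1 : ℂ)))
    (zm : (fun z => qm z + I / z * B) =O[𝓝[Dminus k₀] 0] (fun _ => (1 : ℂ)))
    (hJ : ∀ z ∈ Spec k₀ \ {0}, J z = (z - w)⁻¹ * (qp z - qm z)) [Decidable (w ∈ Dplus k₀)] :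
    IntegrableOnSpec k₀ J ∧
      (if w ∈ Dplus k₀ then qp w else qm w) = e - I / w * B
        + ∑ n, (w - p n)⁻¹ * residue qp (p n) + ∑ n, (w - p' n)⁻¹ * residue qm (p' n)
        + (2 * (Real.pi : ℂ) * I)⁻¹ * specIntegral k₀ J := by
  -- The poles of both regions are pooled, so that the same rational function is subtracted on
  -- either side of `Σ` and creates no jump.
  set P : ι ⊕ ι → ℂ := Sum.elim p p' with hP
  set r : ι ⊕ ι → ℂ := Sum.elim (fun n => residue qp (p n)) (fun n => residue qm (p' n)) with hr
  have h0S : (0 : ℂ) ∈ Spec k₀ := Or.inl zero_im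
  have hDp := Set.disjoint_left.1 (disjoint_Dplus_Spec hk₀)
  have hDm := Set.disjoint_left.1 (disjoint_Dminus_Spec hk₀)
  have hPinj : Function.Injective P := hp.sumElim hp' fun a b h =>
    Set.disjoint_left.1 disjoint_Dplus_Dminus (hpU a) (h ▸ hpU' b)
  have hPS : ∀ k, P k ∉ Spec k₀ := by
    rintro (n | n)
    · exact hDp (hpU n)
    · exact hDm (hpU' n)
  have hP0 : ∀ k, P k ≠ 0 := fun k h => hPS k (h ▸ h0S)
  have hPT : ∀ k, P k ∉ Spec k₀ \ {0} := fun k h => hPS k h.1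
  have hw0 : w ≠ 0 := fun h => hw (h ▸ h0S)
  have hwT : w ∉ Spec k₀ \ {0} := fun h => hw h.1
  have hwP : ∀ k, w ≠ P k := by rintro (n | n); exacts [hwp n, hwp' n]
  have hT0 : (0 : ℂ) ∉ Spec k₀ \ {0} := fun h => h.2 rfl
  have hrp : Set.range p ⊆ Set.range P := by rintro _ ⟨n, rfl⟩; exact ⟨Sum.inl n, rfl⟩
  have hrm : Set.range p' ⊆ Set.range P := by rintro _ ⟨n, rfl⟩; exact ⟨Sum.inr n, rfl⟩
  -- One constant serves both quotients: it removes the singularity at `w` in the region containing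
  -- `w`, and is harmless in the other.
  set c : ℂ := (if w ∈ Dplus k₀ then qp w else qm w) - principalPart Finset.univ e B P r w with hc
  obtain ⟨Fp, dFp, cFp, iFp, zFp, eFp⟩ := exists_cauchy_quotient (c := c) (isOpen_Dplus k₀)
    ((disjoint_Dplus_Spec hk₀).mono_right Set.sdiff_subset) (fun h => hDp h h0S) hT0
    hPinj hP0 hPT hw0 hwT hwP (fun h => by rw [hc, if_pos h])
    (sp.differentiableOn.mono (Set.sdiff_subset_sdiff_right hrp))
    (by
      rintro (n | n) hn
      · exact sp.pole n
      · exact absurd (hpU' n) (Set.disjoint_left.1 disjoint_Dplus_Dminus hn))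
    (cp.mono (Set.union_subset_union_left _ (Set.sdiff_subset_sdiff_right hrp))) ip zp
  obtain ⟨Fm, dFm, cFm, iFm, zFm, eFm⟩ := exists_cauchy_quotient (c := c) (isOpen_Dminus k₀)
    ((disjoint_Dminus_Spec hk₀).mono_right Set.sdiff_subset) (fun h => hDm h h0S) hT0
    hPinj hP0 hPT hw0 hwT hwP
    (fun h => by rw [hc, if_neg fun h' => Set.disjoint_left.1 disjoint_Dplus_Dminus h' h])
    (sm.differentiableOn.mono (Set.sdiff_subset_sdiff_right hrm))
    (by
      rintro (n | n) hn
      · exact absurd hn (Set.disjoint_left.1 disjoint_Dplus_Dminus (hpU n))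
      · exact sm.pole n)
    (cm.mono (Set.union_subset_union_left _ (Set.sdiff_subset_sdiff_right hrm))) im zm
  obtain ⟨hint, hval⟩ := specIntegral_jump hk₀ dFp dFm cFp cFm iFp iFm zFp zFm
    (J := J) fun z hz => by rw [hJ z hz, eFp z hz, eFm z hz]; ring
  refine ⟨hint, ?_⟩
  have h2pi : (2 * (Real.pi : ℂ) * I) ≠ 0 := by simp [Real.pi_ne_zero]
  rw [hval, inv_mul_cancel_left₀ h2pi, hc, principalPart, Fintype.sum_sum_type]
  simp only [hP, hr, Sum.elim_inl, Sum.elim_inr]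
  ring

/-- The points `z n` lie in the upper half plane, while `-k₀² / zₙ* = -k₀² zₙ / |zₙ|²` lies in the
lower one, so the two families cannot meet. -/
lemma zeta_injective {k₀ : ℝ} (hk₀ : 0 < k₀) {N : ℕ} {z : Fin N → ℂ}
    (hz_inj : Function.Injective z) (hz : ∀ n, 0 < (z n).im) : Function.Injective (zeta k₀ z) := by
  have hk : -(k₀ : ℂ) ^ 2 ≠ 0 := by simp [hk₀.ne']
  have hk' : -(k₀ : ℂ) ^ 2 = ((-(k₀ ^ 2) : ℝ) : ℂ) := by push_cast; ring
  have hconj : ∀ n, (starRingEnd ℂ) (z n) ≠ 0 := fun n h => by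
    have := hz n
    rw [(map_eq_zero _).1 h] at this
    simp at this
  refine hz_inj.sumElim (fun a b h => ?_) fun a b h => ?_
  · rw [div_eq_div_iff (hconj a) (hconj b)] at h
    exact hz_inj ((starRingEnd ℂ).injective (mul_left_cancel₀ hk h)).symm
  · have him : (-(k₀ : ℂ) ^ 2 / (starRingEnd ℂ) (z b)).im < 0 := by
      have hpos : 0 < normSq (z b) :=
        normSq_pos.2 fun h0 => by have := hz b; rw [h0] at this; simp at this
      rw [div_eq_mul_inv, hk', im_ofReal_mul, inv_im, conj_im, normSq_conj, neg_neg]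
      exact mul_neg_of_neg_of_pos (by simp; positivity) (div_pos (hz b) hpos)
    rw [← h] at him
    exact lt_asymm him (hz a)

end MmKdV

theorem proposition3p3 {m N : ℕ} (k₀ : ℝ) (hk₀ : 0 < k₀) (x t : ℝ) (Qbdry : Mat m)
    (z : Fin N → ℂ) (hz_inj : Function.Injective z)
    (hz : ∀ n, z n ∈ Dplus k₀ ∧ 0 < (z n).im)
    (a abar ρ ρbar : ℂ → Mat m)
    (ha : HasSimpleZeros a (Dplus k₀) (zeta k₀ z))
    (habar : HasSimpleZeros abar (Dminus k₀) (zetaConj k₀ z))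
    (Qp Qm : ℂ → BlockMat m)
    (hQ : IsRHSolution k₀ x t Qbdry a abar ρ ρbar Qp Qm) :
    ∀ w : ℂ, w ∉ Spec k₀ → (∀ n, w ≠ zeta k₀ z n) → (∀ n, w ≠ zetaConj k₀ z n) →
      (∀ i j, IntegrableOnSpec k₀
        (fun ξ => ((ξ - w)⁻¹ • (Qp ξ * jumpG k₀ x t ρ ρbar ξ)) i j)) ∧
      sectional k₀ Qp Qm w =
        1 - (Complex.I / w) • (sigma3 m * underline Qbdry)
          + ∑ n, (w - zeta k₀ z n)⁻¹ • matResidue Qp (zeta k₀ z n)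
          + ∑ n, (w - zetaConj k₀ z n)⁻¹ • matResidue Qm (zetaConj k₀ z n)
          + (2 * (Real.pi : ℂ) * Complex.I)⁻¹ •
              matSpecIntegral k₀ (fun ξ => (ξ - w)⁻¹ • (Qp ξ * jumpG k₀ x t ρ ρbar ξ)) := by
  intro w hw hwz hwz'
  classical
  have hinj := zeta_injective hk₀ hz_inj fun n => (hz n).2
  have hinj' : Function.Injective (zetaConj k₀ z) := (starRingEnd ℂ).injective.comp hinj
  have hentry : ∀ (Q : ℂ → BlockMat m) (E : Set ℂ), ContinuousOn Q E →
      ∀ i j, ContinuousOn (fun ξ => Q ξ i j) E := fun Q E h i j ξ hξ =>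
    ((continuous_apply_apply i j).tendsto (Q ξ)).comp (h ξ hξ)
  have sp : ∀ i j, HasSimplePoles (fun ξ => Qp ξ i j) (Dplus k₀) (zeta k₀ z) := by
    obtain ⟨W, V, hW, hV, hQp⟩ := hQ.form_plus
    rintro i (j | j)
    · exact ha.hasSimplePoles_mul_inv (isOpen_Dplus k₀) hW i j fun ξ hξ h0 => by
        rw [hQp ξ hξ h0, Matrix.fromCols_apply_inl]
    · exact ha.hasSimplePoles_holo (isOpen_Dplus k₀) hV i j fun ξ hξ h0 => by
        rw [hQp ξ hξ h0, Matrix.fromCols_apply_inr]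
  have sm : ∀ i j, HasSimplePoles (fun ξ => Qm ξ i j) (Dminus k₀) (zetaConj k₀ z) := by
    obtain ⟨V, W, hV, hW, hQm⟩ := hQ.form_minus
    rintro i (j | j)
    · exact habar.hasSimplePoles_holo (isOpen_Dminus k₀) hV i j fun ξ hξ h0 => by
        rw [hQm ξ hξ h0, Matrix.fromCols_apply_inl]
    · exact habar.hasSimplePoles_mul_inv (isOpen_Dminus k₀) hW i j fun ξ hξ h0 => by
        rw [hQm ξ hξ h0, Matrix.fromCols_apply_inr]
  have hdiffp : Dplus k₀ \ Set.range (zeta k₀ z) ⊆ {ξ ∈ Dplus k₀ | (a ξ).det ≠ 0} :=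
    fun ξ hξ => ⟨hξ.1, fun h0 =>
      hξ.2 (((ha.zero_iff ξ hξ.1).1 h0).imp fun _ h => h.symm)⟩
  have hdiffm : Dminus k₀ \ Set.range (zetaConj k₀ z) ⊆ {ξ ∈ Dminus k₀ | (abar ξ).det ≠ 0} :=
    fun ξ hξ => ⟨hξ.1, fun h0 =>
      hξ.2 (((habar.zero_iff ξ hξ.1).1 h0).imp fun _ h => h.symm)⟩
  have key := fun i j => sectional_representation hk₀ (e := (1 : BlockMat m) i j)
    (B := (sigma3 m * underline Qbdry) i j) (w := w)
    (J := fun ξ => ((ξ - w)⁻¹ • (Qp ξ * jumpG k₀ x t ρ ρbar ξ)) i j)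
    hinj hinj' ha.mem habar.mem hw hwz hwz' (sp i j) (sm i j)
    (hentry _ _ (hQ.cont_plus.mono (Set.union_subset_union_left _ hdiffp)) i j)
    (hentry _ _ (hQ.cont_minus.mono (Set.union_subset_union_left _ hdiffm)) i j)
    (hQ.infty_plus i j) (hQ.infty_minus i j) (hQ.zero_plus i j) (hQ.zero_minus i j)
    fun ξ hξ => by
      -- The jump relation says `Q⁺ - Q⁻ = Q⁺ G`, which identifies the integrand.
      rw [hQ.jump ξ hξ, Matrix.mul_sub, Matrix.mul_one, Matrix.sub_apply, sub_sub_cancel,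
        Matrix.smul_apply, smul_eq_mul]
  refine ⟨fun i j => (key i j).1, ?_⟩
  ext i j
  have h := (key i j).2
  have hsec : sectional k₀ Qp Qm w i j = if w ∈ Dplus k₀ then Qp w i j else Qm w i j := by
    unfold sectional
    split_ifs <;> rfl
  rw [hsec, h]
  simp only [Matrix.add_apply, Matrix.sub_apply, Matrix.smul_apply, Matrix.sum_apply, smul_eq_mul,
    matResidue, matSpecIntegral, Matrix.of_apply]
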